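/- Let $\psi\colon[1,\infty)\to(0,\infty)$ be a nondecreasing function which belongs to the class $\mathcal R$, i.e. $\int_1^x\frac{\psi(t)}{t}\,dt=O(\psi(x))$ as $x\to+\infty$, and which has finite order in the sense of Pólya, i.e. $\psi(2x)=O(\psi(x))$ as $x\to+\infty$. Let $\rho=\rho^*[\psi]$ be Pólya's order of $\psi$, i.e. the infimum of those real $\varrho$ for which $\psi(cx)\le c^{\varrho}\psi(x)$ for all sufficiently large $x$ and $c$, and put $s=[\rho]+1$. Let $(z_n)$ be a finite or infinite sequence of distinct nonzero points of the unit disc $\mathbb D=\{z\in\mathbb C:|z|<1\}$. For $\zeta\in\mathbb D$ let $n_\zeta(t)$ be the number (possibly infinite) of members of the sequence with $|z_k-\zeta|\le t$, and let $N_\zeta(r)=\int_0^r\frac{(n_\zeta(t)-1)^+}{t}\,dt\in[0,\infty]$. Let $$P(z)=\prod_{n}E\bigl(A_n(z),s\bigr),\qquad E(w,s)=(1-w)\exp\Bigl(w+\frac{w^2}{2}+\dots+\frac{w^s}{s}\Bigr),\qquad A_n(z)=\frac{1-|z_n|^2}{1-\bar z_n z}$$ be the canonical product of the sequence. Then the condition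 $$\exists C>0\ \ \forall z\in\mathbb D:\quad N_z\Bigl(\frac{1-|z|}{2}\Bigr)\le C\,\psi\Bigl(\frac1{1-|z|}\Bigr)$$ holds if and only if both of the following conditions hold: $$\text{(a)}\quad \exists C>0\ \ \forall z\in\mathbb D:\quad n_z\Bigl(\frac{1-|z|}{2}\Bigr)\le C\,\psi\Bigl(\frac1{1-|z|}\Bigr),$$ $$\text{(b)}\quad \exists C>0\ \ \forall n:\quad \bigl|\ln\bigl((1-|z_n|)\,|P'(z_n)|\bigr)\bigr|\le C\,\psi\Bigl(\frac1{1-|z_n|}\Bigr).$$ Here condition (a) implies $\sum_n(1-|z_n|)^{s+1}<\infty$, which makes $P$ a well-defined analytic function in $\mathbb D$. -/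

import Mathlib

open Filter Asymptotics Set MeasureTheory
open scoped ENNReal

namespace DiscInterpolation

noncomputable section

/-- `ψ̃ (x) = ∫_1^x ψ(t) / t dt`. -/
def logPrimitive (ψ : ℝ → ℝ) (x : ℝ) : ℝ := ∫ t in (1 : ℝ)..x, ψ t / t

/-- The class `R` of regularly growing functions: `ψ : [1, ∞) → (0, ∞)` is nondecreasing and
`ψ̃ (r) = O(ψ(r))` as `r → ∞`. Only the values of `ψ` on `[1, ∞)` matter. -/
structure ClassR (ψ : ℝ → ℝ) : Prop where
  pos : ∀ x, 1 ≤ x → 0 < ψ x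
  mono : MonotoneOn ψ (Ici 1)
  isBigO : logPrimitive ψ =O[atTop] ψ

/-- Finite order in the sense of Pólya: `ψ(2x) = O(ψ(x))` as `x → ∞`. -/
def FinitePolyaOrder (ψ : ℝ → ℝ) : Prop := (fun x => ψ (2 * x)) =O[atTop] ψ

/-- Pólya's order `ρ*[ψ]`: the infimum of the exponents `ρ` such that
`ψ(c x) ≤ c ^ ρ * ψ(x)` for all sufficiently large `x` and `c`. -/
def polyaOrder (ψ : ℝ → ℝ) : ℝ :=
  sInf {ρ : ℝ | ∃ X : ℝ, ∀ x c : ℝ, X ≤ x → X ≤ c → ψ (c * x) ≤ c ^ ρ * ψ x}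

/-- The genus `s = [ρ] + 1`, where `ρ = ρ*[ψ] ≥ 0`. -/
def genus (ψ : ℝ → ℝ) : ℕ := ⌊polyaOrder ψ⌋₊ + 1

variable {ι : Type*}

/-- `n_ζ(t)`: the number (possibly `∞`) of members of `(z_k)` with `|z_k - ζ| ≤ t`. -/
def count (z : ι → ℂ) (ζ : ℂ) (t : ℝ) : ℕ∞ := {k : ι | ‖z k - ζ‖ ≤ t}.encard

/-- `N_ζ(r) = ∫_0^r (n_ζ(t) - 1)^+ / t dt ∈ [0, ∞]`; subtraction in `ℕ∞` is truncated at `0`,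
so that it is the positive part. -/
def logCount (z : ι → ℂ) (ζ : ℂ) (r : ℝ) : ℝ≥0∞ :=
  ∫⁻ t in Ioc 0 r, ((count z ζ t - 1 : ℕ∞) : ℝ≥0∞) / ENNReal.ofReal t

/-- The primary factor `E(w, s) = (1 - w) exp (w + w ^ 2 / 2 + ⋯ + w ^ s / s)`. -/
def primaryFactor (w : ℂ) (s : ℕ) : ℂ :=
  (1 - w) * Complex.exp (∑ j ∈ Finset.Icc 1 s, w ^ j / (j : ℂ))

/-- `A_a(ζ) = (1 - |a|^2) / (1 - \bar a ζ)`. -/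
def kernelA (a ζ : ℂ) : ℂ := (1 - (‖a‖ : ℂ) ^ 2) / (1 - (starRingEnd ℂ) a * ζ)

/-- The canonical product `P(ζ) = ∏_n E(A_{z_n}(ζ), s)`. -/
def canonicalProduct (z : ι → ℂ) (s : ℕ) (ζ : ℂ) : ℂ :=
  ∏' n, primaryFactor (kernelA (z n) ζ) s

/-- `∃ C > 0`, `N_ζ((1 - |ζ|)/2) ≤ C ψ(1/(1 - |ζ|))` for all `ζ` in the unit disc. -/
def LogCountBound (z : ι → ℂ) (ψ : ℝ → ℝ) : Prop :=
  ∃ C : ℝ, 0 < C ∧ ∀ ζ : ℂ, ‖ζ‖ < 1 →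
    logCount z ζ ((1 - ‖ζ‖) / 2) ≤ ENNReal.ofReal (C * ψ (1 / (1 - ‖ζ‖)))

/-- `∃ C > 0`, `n_ζ((1 - |ζ|)/2) ≤ C ψ(1/(1 - |ζ|))` for all `ζ` in the unit disc. -/
def CountBound (z : ι → ℂ) (ψ : ℝ → ℝ) : Prop :=
  ∃ C : ℝ, 0 < C ∧ ∀ ζ : ℂ, ‖ζ‖ < 1 →
    ((count z ζ ((1 - ‖ζ‖) / 2) : ℕ∞) : ℝ≥0∞) ≤ ENNReal.ofReal (C * ψ (1 / (1 - ‖ζ‖)))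

/-- `∃ C > 0`, `|ln ((1 - |z_n|) |P'(z_n)|)| ≤ C ψ(1/(1 - |z_n|))` for all `n`. -/
def DerivBound (z : ι → ℂ) (ψ : ℝ → ℝ) : Prop :=
  ∃ C : ℝ, 0 < C ∧ ∀ n : ι,
    |Real.log ((1 - ‖z n‖) * ‖deriv (canonicalProduct z (genus ψ)) (z n)‖)|
      ≤ C * ψ (1 / (1 - ‖z n‖))

end

end DiscInterpolation

namespace DiscInterpolation

/-! The heart is an identity up to an error: under the density condition (a), ln((1-|z_n|)|P'(z_n)|)
= -N_{z_n}((1-|z_n|)/2) + O(ψ(1/(1-|z_n|))) (`CountBound.exists_abs_log_deriv_add_logCount_le`).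
Given (a), condition (b) therefore says the same as the bound on N at the nodes.

To obtain it, P' at z_n is written as an explicit factor times the product over k ≠ n. A node z_k
near z_n contributes ln|E(A_k(z_n), s)| = -ln(r/|z_k - z_n|) + O(1) with r = (1-|z_n|)/2, and the
logarithms sum to -N_{z_n}(r). A far node contributes O(|A_k(z_n)|^(s+1)). As |A_k| is bounded below
at near nodes, every error is O(|A_k(z_n)|^(s+1)) (`exists_abs_log_norm_primaryFactor_add_le`).

It remains to see that ∑|A_k(ζ)|^(s+1) = O(ψ(1/(1-|ζ|))) (`CountBound.exists_kernelA_bound`). Each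
term is dominated by an integral over a disc about z_k of radius comparable to 1-|z_k|. By (a) these
discs overlap at w at most Cψ(1/(1-|w|)) times, which leaves a weighted area integral. Its radial
part converges with the right size because ψ is in the class R (inner radii) and has order less than
s (outer radii).

Two geometric facts close the equivalence. The bound on N everywhere gives (a), by n(r) ≤ 1 + 2N(2r)
and a finite cover by smaller discs (`LogCountBound.countBound`). The bound on N at the nodes
together with (a) gives it everywhere, by comparing ζ with its closest node
(`logCount_le_of_closest`). -/

/-! ### Growth of ψ -/

theorem ClassR.exists_doubling {ψ : ℝ → ℝ} (hψ : ClassR ψ) (hp : FinitePolyaOrder ψ) :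
    ∃ K : ℝ, 1 ≤ K ∧ ∀ x, 1 ≤ x → ψ (2 * x) ≤ K * ψ x := by
  obtain ⟨c, hc, hb⟩ := hp.exists_pos
  obtain ⟨X, hX⟩ := (eventually_atTop.1 hb.bound)
  set Y := max X 1 with hY
  have hY1 : 1 ≤ Y := le_max_right _ _
  have h1 := hψ.pos 1 le_rfl
  refine ⟨max (max c 1) (ψ (2 * Y) / ψ 1), le_max_of_le_left (le_max_right _ _), fun x hx => ?_⟩
  have hx0 := hψ.pos x hx
  rcases le_total Y x with h | h
  · have := hX x ((le_max_left _ _).trans h)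
    rw [Real.norm_of_nonneg (hψ.pos _ (by linarith)).le, Real.norm_of_nonneg hx0.le] at this
    exact this.trans (mul_le_mul_of_nonneg_right
      (le_max_of_le_left (le_max_left _ _)) hx0.le)
  · have h2 : ψ (2 * x) ≤ ψ (2 * Y) :=
      hψ.mono (show (1:ℝ) ≤ _ by linarith) (show (1:ℝ) ≤ _ by linarith) (by linarith)
    have h3 : ψ 1 ≤ ψ x := hψ.mono (show (1:ℝ) ≤ 1 from le_rfl) hx hx
    calc ψ (2 * x) ≤ ψ (2 * Y) / ψ 1 * ψ 1 := by rwa [div_mul_cancel₀ _ h1.ne']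
      _ ≤ ψ (2 * Y) / ψ 1 * ψ x := by
        have := hψ.pos (2 * Y) (by linarith)
        gcongr
      _ ≤ _ := mul_le_mul_of_nonneg_right (le_max_right _ _) hx0.le

theorem ClassR.le_pow_mul {ψ : ℝ → ℝ} (hψ : ClassR ψ) {K : ℝ} (hK : 1 ≤ K)
    (h : ∀ x, 1 ≤ x → ψ (2 * x) ≤ K * ψ x) (m : ℕ) :
    ∀ x c : ℝ, 1 ≤ x → 1 ≤ c → c ≤ 2 ^ m → ψ (c * x) ≤ K ^ m * ψ x := by
  have key : ∀ x, 1 ≤ x → ψ (2 ^ m * x) ≤ K ^ m * ψ x := by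
    induction m with
    | zero => intro x _; simp
    | succ m ih =>
      intro x hx
      have h1 : (1:ℝ) ≤ 2 ^ m * x := one_le_mul_of_one_le_of_one_le (one_le_pow₀ one_le_two) hx
      calc ψ (2 ^ (m + 1) * x) = ψ (2 * (2 ^ m * x)) := by ring_nf
        _ ≤ K * (K ^ m * ψ x) := (h _ h1).trans (by gcongr; exact ih x hx)
        _ = _ := by ring
  intro x c hx hc hcm
  refine (hψ.mono ?_ ?_ ?_).trans (key x hx)
  · exact one_le_mul_of_one_le_of_one_le hc hx
  · exact one_le_mul_of_one_le_of_one_le (hc.trans hcm) hx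
  · gcongr

theorem ClassR.exists_le_mul {ψ : ℝ → ℝ} (hψ : ClassR ψ) (hp : FinitePolyaOrder ψ) (c : ℝ) :
    ∃ K : ℝ, 1 ≤ K ∧ ∀ x, 1 ≤ x → ∀ y, 1 ≤ y → y ≤ c * x → ψ y ≤ K * ψ x := by
  obtain ⟨K, hK, h⟩ := hψ.exists_doubling hp
  obtain ⟨m, hm⟩ := pow_unbounded_of_one_lt c (one_lt_two)
  refine ⟨K ^ m, one_le_pow₀ hK, fun x hx y hy hyc => ?_⟩
  have := hψ.le_pow_mul hK h m x (2 ^ m) hx (one_le_pow₀ one_le_two) le_rfl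
  refine (hψ.mono hy ?_ (hyc.trans ?_)).trans this
  · exact one_le_mul_of_one_le_of_one_le (one_le_pow₀ one_le_two) hx
  · gcongr

/-- Needed so that the set in `polyaOrder` is nonempty and its `sInf` is not a default value.
Doubling is iterated ⌈log₂ c⌉ ≤ 2 log₂ c times, which gives the exponent 2 log₂ K. -/
theorem ClassR.exists_polya_exponent {ψ : ℝ → ℝ} (hψ : ClassR ψ) (hp : FinitePolyaOrder ψ) :
    ∃ ρ X : ℝ, ∀ x c : ℝ, X ≤ x → X ≤ c → ψ (c * x) ≤ c ^ ρ * ψ x := by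
  obtain ⟨K, hK, h⟩ := hψ.exists_doubling hp
  refine ⟨2 * Real.logb 2 K, 2, fun x c hx hc => ?_⟩
  have hx0 := hψ.pos x (by linarith)
  have hc0 : 0 < c := by linarith
  set m := ⌈Real.logb 2 c⌉₊ with hm
  have hl1 : 1 ≤ Real.logb 2 c := by
    rw [Real.le_logb_iff_rpow_le one_lt_two hc0]; simpa
  have h1 : c ≤ 2 ^ m := by
    rw [← Real.rpow_natCast, ← Real.logb_le_iff_le_rpow one_lt_two hc0]
    exact Nat.le_ceil _
  have h2 : (m : ℝ) ≤ 2 * Real.logb 2 c := by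
    have := Nat.ceil_lt_add_one (show 0 ≤ Real.logb 2 c by linarith)
    linarith
  refine (hψ.le_pow_mul hK h m x c (by linarith) (by linarith) h1).trans ?_
  gcongr
  calc K ^ m = K ^ (m : ℝ) := (Real.rpow_natCast _ _).symm
    _ ≤ K ^ (2 * Real.logb 2 c) := Real.rpow_le_rpow_of_exponent_le hK h2
    _ = c ^ (2 * Real.logb 2 K) := by
      rw [Real.rpow_def_of_pos (by linarith), Real.rpow_def_of_pos hc0]
      simp only [Real.logb]
      congr 1
      ring

/-- Growth of order strictly less than the genus. -/
theorem ClassR.exists_growth {ψ : ℝ → ℝ} (hψ : ClassR ψ) (hp : FinitePolyaOrder ψ) :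
    ∃ ρ M : ℝ, 0 ≤ ρ ∧ ρ < genus ψ ∧ 0 < M ∧
      ∀ x c : ℝ, 1 ≤ x → 1 ≤ c → ψ (c * x) ≤ M * c ^ ρ * ψ x := by
  have hlt : polyaOrder ψ < genus ψ := by
    unfold genus; push_cast; exact Nat.lt_floor_add_one _
  obtain ⟨ρ, ⟨X, hX⟩, hρ⟩ := exists_lt_of_csInf_lt (hψ.exists_polya_exponent hp) hlt
  set Y := max X 1 with hY
  have hY1 : 1 ≤ Y := le_max_right _ _
  have hXY : X ≤ Y := le_max_left _ _
  obtain ⟨K, hK, hKY⟩ := hψ.exists_le_mul hp Y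
  -- The thresholds on x and c disappear after both are multiplied by Y: this costs Y^ρ in c and, by
  -- doubling, K in ψ(Y x).
  refine ⟨max ρ 0, Y ^ (max ρ 0) * K, le_max_right _ _, max_lt hρ (by simp only [genus]; positivity), by positivity,
    fun x c hx hc => ?_⟩
  have hYx : 1 ≤ Y * x := one_le_mul_of_one_le_of_one_le hY1 hx
  have hYc : 1 ≤ Y * c := one_le_mul_of_one_le_of_one_le hY1 hc
  have hcx : 1 ≤ c * x := one_le_mul_of_one_le_of_one_le hc hx
  have hx0 := hψ.pos x hx
  have hle : c * x ≤ Y * c * (Y * x) := by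
    have h1 : c ≤ Y * c := le_mul_of_one_le_left (by linarith) hY1
    have h2 : x ≤ Y * x := le_mul_of_one_le_left (by linarith) hY1
    gcongr
  calc ψ (c * x) ≤ ψ (Y * c * (Y * x)) :=
        hψ.mono hcx (one_le_mul_of_one_le_of_one_le hYc hYx) hle
    _ ≤ (Y * c) ^ ρ * ψ (Y * x) := hX _ _ (by nlinarith) (by nlinarith)
    _ ≤ (Y * c) ^ (max ρ 0) * (K * ψ x) := by
      have := hψ.pos _ hYx
      have := hKY x hx _ hYx le_rfl
      have := Real.rpow_le_rpow_of_exponent_le hYc (le_max_left ρ 0)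
      gcongr
    _ = _ := by rw [Real.mul_rpow (by linarith) (by linarith)]; ring

theorem ClassR.intervalIntegrable {ψ : ℝ → ℝ} (hψ : ClassR ψ) {x : ℝ} (hx : 1 ≤ x) :
    IntervalIntegrable (fun t => ψ t / t) volume 1 x := by
  simp_rw [div_eq_mul_inv]
  have hs : uIcc 1 x ⊆ Ici 1 := by rw [uIcc_of_le hx]; exact Icc_subset_Ici_self
  refine (hψ.mono.mono hs).intervalIntegrable.mul_continuousOn ?_
  exact continuousOn_inv₀.mono fun t ht => by
    have : (1:ℝ) ≤ t := hs ht
    simp; linarith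

theorem ClassR.exists_logPrimitive_le {ψ : ℝ → ℝ} (hψ : ClassR ψ) :
    ∃ C : ℝ, 0 < C ∧ ∀ x, 1 ≤ x → logPrimitive ψ x ≤ C * ψ x := by
  obtain ⟨c, hc, hb⟩ := hψ.isBigO.exists_pos
  obtain ⟨X, hX⟩ := (eventually_atTop.1 hb.bound)
  set Y := max X 1 with hY
  have hY1 : 1 ≤ Y := le_max_right _ _
  have hmono : ∀ x y, 1 ≤ x → x ≤ y → logPrimitive ψ x ≤ logPrimitive ψ y := by
    intro x y hx hxy
    refine intervalIntegral.integral_mono_interval le_rfl hx hxy ?_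
      (hψ.intervalIntegrable (hx.trans hxy))
    refine (ae_restrict_iff' measurableSet_Ioc).2 (ae_of_all _ fun t ht => ?_)
    have := hψ.pos t ht.1.le
    have := ht.1
    simp only [Pi.zero_apply]; positivity
  have h1 := hψ.pos 1 le_rfl
  have hn : 0 ≤ logPrimitive ψ Y := by
    have := hmono 1 Y le_rfl hY1
    simpa [logPrimitive] using this
  refine ⟨c + logPrimitive ψ Y / ψ 1, by positivity, fun x hx => ?_⟩
  have hx0 := hψ.pos x hx
  have h3 : ψ 1 ≤ ψ x := hψ.mono (show (1:ℝ) ≤ 1 from le_rfl) hx hx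
  rw [add_mul]
  rcases le_total Y x with h | h
  · have := hX x ((le_max_left _ _).trans h)
    rw [Real.norm_of_nonneg hx0.le] at this
    have h4 := (le_abs_self _).trans this
    have : 0 ≤ logPrimitive ψ Y / ψ 1 * ψ x := by positivity
    linarith
  · have := hmono x Y hx h
    have h5 : logPrimitive ψ Y ≤ logPrimitive ψ Y / ψ 1 * ψ x := by
      calc logPrimitive ψ Y = logPrimitive ψ Y / ψ 1 * ψ 1 := by field_simp
        _ ≤ _ := by gcongr
    have : 0 ≤ c * ψ x := by positivity
    linarith

/-! ### Primary factors -/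

/-- The polynomial `w + w ^ 2 / 2 + ⋯ + w ^ s / s`. -/
noncomputable def logPoly (s : ℕ) (w : ℂ) : ℂ := ∑ j ∈ Finset.Icc 1 s, w ^ j / (j : ℂ)

theorem primaryFactor_eq (w : ℂ) (s : ℕ) :
    primaryFactor w s = (1 - w) * Complex.exp (logPoly s w) := rfl

theorem continuous_logPoly (s : ℕ) : Continuous (logPoly s) := by
  unfold logPoly; fun_prop

theorem logTaylor_neg (s : ℕ) (w : ℂ) : Complex.logTaylor (s + 1) (-w) = -logPoly s w := by
  induction s with
  | zero => simp [Complex.logTaylor, logPoly]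
  | succ s ih =>
    rw [Complex.logTaylor_succ, Pi.add_apply, ih, logPoly, logPoly,
      Finset.sum_Icc_succ_top (by omega)]
    have : (-1 : ℂ) ^ (s + 1 + 1) * (-w) ^ (s + 1) = -(w ^ (s + 1)) := by
      rw [neg_pow w, ← mul_assoc, ← pow_add, Odd.neg_one_pow ⟨s + 1, by ring⟩]; ring
    rw [this]; ring

theorem norm_log_add_logPoly_le (s : ℕ) {w : ℂ} (hw : ‖w‖ ≤ 1 / 2) :
    ‖Complex.log (1 - w) + logPoly s w‖ ≤ 2 * ‖w‖ ^ (s + 1) := by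
  have h := Complex.norm_log_sub_logTaylor_le s (z := -w) (by rw [norm_neg]; linarith)
  rw [logTaylor_neg, norm_neg, sub_neg_eq_add, ← sub_eq_add_neg] at h
  refine h.trans ?_
  have h1 : (1 - ‖w‖)⁻¹ ≤ 2 := by
    rw [inv_le_comm₀ (by linarith) (by norm_num)]; linarith
  have h2 : 0 ≤ (1 - ‖w‖)⁻¹ := inv_nonneg.2 (by linarith)
  calc ‖w‖ ^ (s + 1) * (1 - ‖w‖)⁻¹ / (s + 1) ≤ ‖w‖ ^ (s + 1) * (1 - ‖w‖)⁻¹ :=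
        div_le_self (by positivity) (by linarith [(Nat.cast_nonneg s : (0:ℝ) ≤ s)])
    _ ≤ ‖w‖ ^ (s + 1) * 2 := by gcongr
    _ = _ := mul_comm _ _

theorem primaryFactor_eq_exp (s : ℕ) {w : ℂ} (hw : w ≠ 1) :
    primaryFactor w s = Complex.exp (Complex.log (1 - w) + logPoly s w) := by
  rw [primaryFactor_eq, Complex.exp_add, Complex.exp_log (sub_ne_zero.2 hw.symm)]

theorem log_norm_primaryFactor (s : ℕ) {w : ℂ} (hw : w ≠ 1) :
    Real.log ‖primaryFactor w s‖ = Real.log ‖1 - w‖ + (logPoly s w).re := by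
  rw [primaryFactor_eq, norm_mul, Complex.norm_exp, Real.log_mul, Real.log_exp]
  · simpa using sub_ne_zero.2 hw.symm
  · exact (Real.exp_pos _).ne'

theorem primaryFactor_ne_zero (s : ℕ) {w : ℂ} (hw : w ≠ 1) : primaryFactor w s ≠ 0 := by
  rw [primaryFactor_eq]
  exact mul_ne_zero (sub_ne_zero.2 hw.symm) (Complex.exp_ne_zero _)

theorem abs_log_norm_primaryFactor_le (s : ℕ) {w : ℂ} (hw : ‖w‖ ≤ 1 / 2) :
    |Real.log ‖primaryFactor w s‖| ≤ 2 * ‖w‖ ^ (s + 1) := by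
  have hw1 : w ≠ 1 := by rintro rfl; norm_num at hw
  rw [primaryFactor_eq_exp s hw1, Complex.norm_exp, Real.log_exp]
  exact (Complex.abs_re_le_norm _).trans (norm_log_add_logPoly_le s hw)

theorem exists_norm_logPoly_le (s : ℕ) : ∃ C : ℝ, 0 ≤ C ∧ ∀ w : ℂ, ‖w‖ ≤ 2 → ‖logPoly s w‖ ≤ C := by
  obtain ⟨C, hC⟩ := (isCompact_closedBall (0 : ℂ) 2).exists_bound_of_continuousOn
    (continuous_logPoly s).continuousOn
  exact ⟨C, (norm_nonneg _).trans (hC 0 (by simp)), fun w hw => hC w (by simpa using hw)⟩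

/-- For |w| ≤ 1/2 this is the Taylor remainder of log(1-w). For 1/2 ≤ |w| ≤ 2 the left side is
bounded and 2|w| ≥ 1. The range |w| ≤ 2 is the one in which the kernels A_n take their values. -/
theorem exists_norm_primaryFactor_sub_one_le (s : ℕ) :
    ∃ C : ℝ, 0 ≤ C ∧ ∀ w : ℂ, ‖w‖ ≤ 2 → ‖primaryFactor w s - 1‖ ≤ C * ‖w‖ ^ (s + 1) := by
  obtain ⟨L, hL0, hL⟩ := exists_norm_logPoly_le s
  refine ⟨max 4 ((3 * Real.exp L + 1) * 2 ^ (s + 1)), le_max_of_le_left (by norm_num),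
    fun w hw => ?_⟩
  rcases le_total ‖w‖ (1 / 2) with h | h
  · have hw1 : w ≠ 1 := by rintro rfl; norm_num at h
    have h1 := norm_log_add_logPoly_le s h
    have h2 : ‖w‖ ^ (s + 1) ≤ 1 / 2 :=
      (pow_le_of_le_one (norm_nonneg _) (by linarith) (by omega)).trans h
    rw [primaryFactor_eq_exp s hw1]
    calc _ ≤ 2 * ‖Complex.log (1 - w) + logPoly s w‖ := Complex.norm_exp_sub_one_le (by linarith)
      _ ≤ 4 * ‖w‖ ^ (s + 1) := by linarith
      _ ≤ _ := by gcongr; exact le_max_left _ _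
  · have h1 : ‖primaryFactor w s‖ ≤ 3 * Real.exp L := by
      rw [primaryFactor_eq, norm_mul, Complex.norm_exp]
      have h3 : ‖1 - w‖ ≤ 3 := (norm_sub_le _ _).trans (by rw [norm_one]; linarith)
      have h4 : (logPoly s w).re ≤ L := (Complex.re_le_norm _).trans (hL w hw)
      gcongr
    have h2 : 1 ≤ 2 ^ (s + 1) * ‖w‖ ^ (s + 1) := by
      rw [← mul_pow]; exact one_le_pow₀ (by linarith)
    calc ‖primaryFactor w s - 1‖ ≤ 3 * Real.exp L + 1 :=
          (norm_sub_le _ _).trans (by rw [norm_one]; linarith)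
      _ ≤ (3 * Real.exp L + 1) * (2 ^ (s + 1) * ‖w‖ ^ (s + 1)) :=
          le_mul_of_one_le_right (by positivity) h2
      _ = (3 * Real.exp L + 1) * 2 ^ (s + 1) * ‖w‖ ^ (s + 1) := by ring
      _ ≤ _ := by gcongr; exact le_max_right _ _

/-! ### The kernel A and the logarithm of a single factor -/

theorem one_sub_norm_le_norm_one_sub {a ζ : ℂ} (hζ : ‖ζ‖ ≤ 1) :
    1 - ‖a‖ ≤ ‖1 - (starRingEnd ℂ) a * ζ‖ := by
  have h1 : ‖(starRingEnd ℂ) a * ζ‖ ≤ ‖a‖ := by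
    rw [norm_mul, RCLike.norm_conj]; exact mul_le_of_le_one_right (norm_nonneg _) hζ
  have h2 := norm_sub_norm_le 1 ((starRingEnd ℂ) a * ζ)
  rw [norm_one] at h2
  linarith

theorem one_sub_norm_le_norm_one_sub' {a ζ : ℂ} (ha : ‖a‖ ≤ 1) :
    1 - ‖ζ‖ ≤ ‖1 - (starRingEnd ℂ) a * ζ‖ := by
  have h1 : ‖(starRingEnd ℂ) a * ζ‖ ≤ ‖ζ‖ := by
    rw [norm_mul, RCLike.norm_conj]; exact mul_le_of_le_one_left (norm_nonneg _) ha
  have h2 := norm_sub_norm_le 1 ((starRingEnd ℂ) a * ζ)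
  rw [norm_one] at h2
  linarith

theorem one_sub_conj_mul_ne_zero {a ζ : ℂ} (ha : ‖a‖ < 1) (hζ : ‖ζ‖ ≤ 1) :
    1 - (starRingEnd ℂ) a * ζ ≠ 0 := by
  rw [← norm_pos_iff]; linarith [one_sub_norm_le_norm_one_sub (a := a) hζ]

theorem norm_kernelA {a : ℂ} (ha : ‖a‖ ≤ 1) (ζ : ℂ) :
    ‖kernelA a ζ‖ = (1 - ‖a‖ ^ 2) / ‖1 - (starRingEnd ℂ) a * ζ‖ := by
  rw [kernelA, norm_div]
  congr 1
  rw [← Complex.ofReal_one, ← Complex.ofReal_pow, ← Complex.ofReal_sub, Complex.norm_real,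
    Real.norm_of_nonneg]
  nlinarith [norm_nonneg a]

theorem norm_kernelA_le {a : ℂ} (ha : ‖a‖ ≤ 1) (ζ : ℂ) :
    ‖kernelA a ζ‖ ≤ 2 * ((1 - ‖a‖) / ‖1 - (starRingEnd ℂ) a * ζ‖) := by
  rw [norm_kernelA ha, ← mul_div_assoc]
  gcongr
  nlinarith [norm_nonneg a]

theorem le_norm_kernelA {a : ℂ} (ha : ‖a‖ ≤ 1) (ζ : ℂ) :
    (1 - ‖a‖) / ‖1 - (starRingEnd ℂ) a * ζ‖ ≤ ‖kernelA a ζ‖ := by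
  rw [norm_kernelA ha]
  gcongr
  nlinarith [norm_nonneg a]

theorem norm_kernelA_le_two {a ζ : ℂ} (ha : ‖a‖ < 1) (hζ : ‖ζ‖ ≤ 1) : ‖kernelA a ζ‖ ≤ 2 := by
  refine (norm_kernelA_le ha.le ζ).trans ?_
  have h := one_sub_norm_le_norm_one_sub (a := a) hζ
  have : (1 - ‖a‖) / ‖1 - (starRingEnd ℂ) a * ζ‖ ≤ 1 := (div_le_one (by linarith)).2 h
  linarith

theorem one_sub_kernelA {a ζ : ℂ} (ha : ‖a‖ < 1) (hζ : ‖ζ‖ ≤ 1) :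
    1 - kernelA a ζ = (starRingEnd ℂ) a * (a - ζ) / (1 - (starRingEnd ℂ) a * ζ) := by
  have h := one_sub_conj_mul_ne_zero ha hζ
  have h2 : (starRingEnd ℂ) a * a = (‖a‖ : ℂ) ^ 2 := by rw [mul_comm, Complex.mul_conj']
  rw [kernelA, eq_div_iff h, sub_mul, div_mul_cancel₀ _ h, ← h2]
  ring

theorem norm_one_sub_kernelA {a ζ : ℂ} (ha : ‖a‖ < 1) (hζ : ‖ζ‖ ≤ 1) :
    ‖1 - kernelA a ζ‖ = ‖a‖ * ‖a - ζ‖ / ‖1 - (starRingEnd ℂ) a * ζ‖ := by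
  rw [one_sub_kernelA ha hζ, norm_div, norm_mul, RCLike.norm_conj]

theorem kernelA_ne_one {a ζ : ℂ} (ha : ‖a‖ < 1) (ha0 : a ≠ 0) (hζ : ‖ζ‖ ≤ 1) (h : a ≠ ζ) :
    kernelA a ζ ≠ 1 := by
  intro h1
  have h2 := one_sub_kernelA ha hζ
  rw [h1, sub_self, eq_comm, div_eq_zero_iff] at h2
  simp [ha0, sub_ne_zero.2 h, one_sub_conj_mul_ne_zero ha hζ] at h2

theorem kernelA_self {a : ℂ} (ha : ‖a‖ < 1) : kernelA a a = 1 := by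
  have h := one_sub_kernelA ha ha.le
  rw [sub_self, mul_zero, zero_div] at h
  exact (sub_eq_zero.1 h).symm

/-- With `one_sub_norm_le_norm_one_sub'`, this makes |1 - b̄a| comparable to 1-|a| when b is near a.
-/
theorem norm_one_sub_conj_mul_le (a b : ℂ) (ha : ‖a‖ < 1) :
    ‖1 - (starRingEnd ℂ) b * a‖ ≤ 2 * (1 - ‖a‖) + ‖b - a‖ := by
  have h : 1 - (starRingEnd ℂ) b * a = ((1 - ‖a‖ ^ 2 : ℝ) : ℂ) - (starRingEnd ℂ) (b - a) * a := by
    have h2 : (starRingEnd ℂ) a * a = (‖a‖ : ℂ) ^ 2 := by rw [mul_comm, Complex.mul_conj']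
    push_cast
    rw [← h2, map_sub]
    ring
  rw [h]
  refine (norm_sub_le _ _).trans ?_
  rw [Complex.norm_real, norm_mul, RCLike.norm_conj, Real.norm_of_nonneg
    (by nlinarith [norm_nonneg a])]
  have := mul_le_of_le_one_right (norm_nonneg (b - a)) ha.le
  nlinarith [norm_nonneg a]

/-- The logarithm of a factor of the canonical product compensates the contribution of the
corresponding node to the logarithmic counting function. -/
theorem exists_abs_log_norm_primaryFactor_add_le (s : ℕ) {η : ℝ} (hη : 0 < η) :
    ∃ B : ℝ, 0 < B ∧ ∀ a b : ℂ, ‖a‖ < 1 → ‖b‖ < 1 → η ≤ ‖b‖ → b ≠ a →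
      |Real.log ‖primaryFactor (kernelA b a) s‖ +
        (if ‖b - a‖ ≤ (1 - ‖a‖) / 2 then Real.log ((1 - ‖a‖) / 2 / ‖b - a‖) else 0)|
        ≤ B * ‖kernelA b a‖ ^ (s + 1) := by
  obtain ⟨L, hL0, hL⟩ := exists_norm_logPoly_le s
  refine ⟨(|Real.log η| + Real.log 12 + Real.log 3 + L + 2) * 6 ^ (s + 1), by positivity,
    fun a b ha hb hηb hba => ?_⟩
  have hb0 : 0 < ‖b‖ := hη.trans_le hηb
  have hbne : b ≠ 0 := norm_pos_iff.1 hb0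
  have hA1 := kernelA_ne_one hb hbne ha.le hba
  have hd : 0 < ‖b - a‖ := norm_pos_iff.2 (sub_ne_zero.2 hba)
  set D := ‖1 - (starRingEnd ℂ) b * a‖ with hD
  have hDa : 1 - ‖a‖ ≤ D := one_sub_norm_le_norm_one_sub' hb.le
  have hD0 : 0 < D := by linarith
  have hDle : D ≤ 2 * (1 - ‖a‖) + ‖b - a‖ := norm_one_sub_conj_mul_le a b ha
  have hP : |(logPoly s (kernelA b a)).re| ≤ L :=
    (Complex.abs_re_le_norm _).trans (hL _ (norm_kernelA_le_two hb ha.le))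
  have hlogη : |Real.log ‖b‖| ≤ |Real.log η| := by
    have h1 : Real.log η ≤ Real.log ‖b‖ := Real.log_le_log hη hηb
    have h2 : Real.log ‖b‖ ≤ 0 := Real.log_nonpos hb0.le hb.le
    rw [abs_of_nonpos h2, abs_of_nonpos (h1.trans h2)]; linarith
  have hlog3 : (0:ℝ) ≤ Real.log 3 := Real.log_nonneg (by norm_num)
  have hlog12 : (0:ℝ) ≤ Real.log 12 := Real.log_nonneg (by norm_num)
  have hn1 := norm_one_sub_kernelA hb ha.le (a := b) (ζ := a)
  rw [← hD] at hn1
  -- Where |A| ≥ 1/6, any bounded quantity is absorbed, since (6|A|)^(s+1) ≥ 1.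
  have hbig : 1 / 6 ≤ ‖kernelA b a‖ → ∀ X : ℝ,
      |X| ≤ |Real.log η| + Real.log 12 + Real.log 3 + L + 2 →
      |X| ≤ (|Real.log η| + Real.log 12 + Real.log 3 + L + 2) * 6 ^ (s + 1) *
        ‖kernelA b a‖ ^ (s + 1) := by
    intro h X hX
    refine hX.trans ?_
    rw [mul_assoc, ← mul_pow]
    exact le_mul_of_one_le_right (by positivity) (one_le_pow₀ (by linarith))
  have hba' : ‖b‖ - ‖a‖ ≤ ‖b - a‖ := norm_sub_norm_le _ _
  split_ifs with hnear
  · refine hbig ?_ _ ?_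
    · refine le_trans ?_ (le_norm_kernelA hb.le a)
      rw [← hD, div_le_div_iff₀ (by norm_num) hD0]
      linarith
    -- As |1 - A| = |b||b - a|/D, the singular term ln|b - a| cancels; the lower bound η on |b| and
    -- D comparable to 1-|a| bound the rest.
    · have hcalc : Real.log ‖primaryFactor (kernelA b a) s‖ + Real.log ((1 - ‖a‖) / 2 / ‖b - a‖) =
          Real.log ‖b‖ + Real.log ((1 - ‖a‖) / 2 / D) + (logPoly s (kernelA b a)).re := by
        rw [log_norm_primaryFactor s hA1, hn1,
          Real.log_div (by positivity) hD0.ne', Real.log_mul hb0.ne' hd.ne',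
          Real.log_div (by linarith) hd.ne', Real.log_div (by linarith) hD0.ne']
        ring
      rw [hcalc]
      have h3 : |Real.log ((1 - ‖a‖) / 2 / D)| ≤ Real.log 12 := by
        have hle1 : (1 - ‖a‖) / 2 / D ≤ 1 := by rw [div_le_one hD0]; linarith
        have hge : (12 : ℝ)⁻¹ ≤ (1 - ‖a‖) / 2 / D := by
          rw [le_div_iff₀ hD0]; linarith
        have h5 := Real.log_le_log (by norm_num) hge
        rw [Real.log_inv] at h5
        rw [abs_of_nonpos (Real.log_nonpos (by positivity) hle1)]
        linarith
      have := abs_add_le (Real.log ‖b‖ + Real.log ((1 - ‖a‖) / 2 / D))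
        (logPoly s (kernelA b a)).re
      have := abs_add_le (Real.log ‖b‖) (Real.log ((1 - ‖a‖) / 2 / D))
      linarith
  · rw [add_zero]
    push Not at hnear
    rcases le_total ‖kernelA b a‖ (1 / 2) with hA | hA
    · refine (abs_log_norm_primaryFactor_le s hA).trans ?_
      gcongr
      refine le_trans ?_ (le_mul_of_one_le_right (by positivity) (one_le_pow₀ (by norm_num)))
      linarith [abs_nonneg (Real.log η)]
    · refine hbig (by linarith) _ ?_
      have hsplit : Real.log ‖1 - kernelA b a‖ = Real.log ‖b‖ + Real.log (‖b - a‖ / D) := by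
        rw [hn1, mul_div_assoc, Real.log_mul hb0.ne' (by positivity)]
      rw [log_norm_primaryFactor s hA1]
      have hD4 : D ≤ 4 * (1 - ‖b‖) := by
        have h6 := hA.trans (norm_kernelA_le hb.le a)
        rw [← hD, ← mul_div_assoc, div_le_div_iff₀ (by norm_num) hD0] at h6
        linarith
      have hab : ‖a‖ - ‖b‖ ≤ ‖b - a‖ := by rw [norm_sub_rev]; exact norm_sub_norm_le _ _
      have h3 : |Real.log ‖1 - kernelA b a‖| ≤ |Real.log η| + Real.log 12 + Real.log 3 := by
        -- Since b is far, 1-|b| ≤ (1-|a|) + |b - a| ≤ 3|b - a|, and D ≤ 4(1-|b|) gives 12.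
        have hge : (12 : ℝ)⁻¹ ≤ ‖b - a‖ / D := by rw [le_div_iff₀ hD0]; linarith
        have hle3 : ‖1 - kernelA b a‖ ≤ 3 := by
          have h8 := norm_sub_le 1 (kernelA b a)
          rw [norm_one] at h8
          linarith [norm_kernelA_le_two hb ha.le]
        have h5 := Real.log_le_log (by norm_num) hge
        have h6 := Real.log_le_log (norm_pos_iff.2 (sub_ne_zero.2 hA1.symm)) hle3
        rw [Real.log_inv] at h5
        have h7 := neg_le_of_abs_le hlogη
        rw [abs_le]
        constructor
        · linarith
        · linarith [abs_nonneg (Real.log η)]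
      have := abs_add_le (Real.log ‖1 - kernelA b a‖) (logPoly s (kernelA b a)).re
      linarith

/-! ### The weighted area integral -/

theorem ClassR.lintegral_div_eq {ψ : ℝ → ℝ} (hψ : ClassR ψ) {x : ℝ} (hx : 1 ≤ x) :
    ∫⁻ t in Ioc 1 x, ENNReal.ofReal (ψ t / t) = ENNReal.ofReal (logPrimitive ψ x) := by
  rw [logPrimitive, intervalIntegral.integral_of_le hx, ofReal_integral_eq_lintegral_ofReal]
  · exact (hψ.intervalIntegrable hx).1
  · refine (ae_restrict_iff' measurableSet_Ioc).2 (ae_of_all _ fun t ht => ?_)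
    have := hψ.pos t ht.1.le
    have := ht.1
    simp only [Pi.zero_apply]; positivity

/-- The substitution t = 1/(1-r) turns the integrand into ψ(t)/t. -/
theorem ClassR.lintegral_inner_le {ψ : ℝ → ℝ} (hψ : ClassR ψ) {q : ℝ} (hq0 : 0 ≤ q) (hq : q < 1) :
    ∫⁻ r in Ioc 0 q, ENNReal.ofReal (ψ (1 / (1 - r)) / (1 - r)) ≤
      ENNReal.ofReal (logPrimitive ψ (1 / (1 - q))) := by
  have h1q : 0 < 1 - q := by linarith
  have hder : ∀ r ∈ Ioc 0 q,
      HasDerivWithinAt (fun r : ℝ => 1 / (1 - r)) (1 / (1 - r) ^ 2) (Ioc 0 q) r := by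
    intro r hr
    have h1 : (1 - r) ≠ 0 := by have := hr.2; intro h; linarith
    have := ((hasDerivAt_id r).const_sub 1).inv h1
    simp only [one_div]
    refine HasDerivAt.hasDerivWithinAt ?_
    convert! this using 1
    simp
  have hinj : InjOn (fun r : ℝ => 1 / (1 - r)) (Ioc 0 q) := by
    intro a _ b _ h
    simp only [one_div, inv_inj] at h
    linarith
  have := lintegral_image_eq_lintegral_abs_deriv_mul measurableSet_Ioc hder hinj
    (fun t => ENNReal.ofReal (ψ t / t))
  rw [← hψ.lintegral_div_eq (by rw [le_div_iff₀ h1q]; linarith)]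
  calc _ = ∫⁻ r in Ioc 0 q, ENNReal.ofReal (|1 / (1 - r) ^ 2|) *
          ENNReal.ofReal (ψ (1 / (1 - r)) / (1 / (1 - r))) := by
        refine setLIntegral_congr_fun measurableSet_Ioc fun r hr => ?_
        have h1 : 0 < 1 - r := by have := hr.2; linarith
        rw [← ENNReal.ofReal_mul (abs_nonneg _), abs_of_pos (by positivity)]
        congr 1
        field_simp
    _ = ∫⁻ t in (fun r : ℝ => 1 / (1 - r)) '' Ioc 0 q, ENNReal.ofReal (ψ t / t) := this.symm
    _ ≤ _ := by
        refine lintegral_mono_set ?_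
        rintro _ ⟨r, hr, rfl⟩
        have h1 : 0 < 1 - r := by have := hr.2; linarith
        refine ⟨?_, ?_⟩
        · simp only; rw [lt_div_iff₀ h1]; linarith [hr.1]
        · simp only; exact one_div_le_one_div_of_le h1q (by linarith [hr.2])

theorem lintegral_one_sub_rpow {p q : ℝ} (hp : -1 < p) (hq : q ≤ 1) :
    ∫⁻ r in Ioc q 1, ENNReal.ofReal ((1 - r) ^ p) =
      ENNReal.ofReal ((1 - q) ^ (p + 1) / (p + 1)) := by
  have hint : IntervalIntegrable (fun r : ℝ => (1 - r) ^ p) volume q 1 := by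
    have := (intervalIntegral.intervalIntegrable_rpow' (a := 1 - q) (b := 0) hp).comp_sub_left 1
    simpa using this
  rw [← ofReal_integral_eq_lintegral_ofReal hint.1, ← intervalIntegral.integral_of_le hq]
  · rw [intervalIntegral.integral_comp_sub_left (fun x => x ^ p) 1, sub_self,
      integral_rpow (Or.inl hp), Real.zero_rpow (by linarith), sub_zero]
  · refine (ae_restrict_iff' measurableSet_Ioc).2 (ae_of_all _ fun t ht => ?_)
    exact Real.rpow_nonneg (by linarith [ht.2]) _

/-- The integral is split at r = q. For r ≤ q, 1-rq ≥ 1-r leaves the logarithmic primitive,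
controlled by the class R. For r > q, 1-rq ≥ 1-q and the growth exponent ρ of ψ leave (1-r)^(m-ρ),
integrable because ρ < m + 1, the genus. -/
theorem ClassR.exists_radial_bound {ψ : ℝ → ℝ} (hψ : ClassR ψ) (hp : FinitePolyaOrder ψ)
    {m : ℕ} (hm : genus ψ = m + 1) :
    ∃ C : ℝ, 0 < C ∧ ∀ q : ℝ, 0 ≤ q → q < 1 →
      ∫⁻ r in Ioo 0 1, ENNReal.ofReal ((1 - r) ^ m * ψ (1 / (1 - r)) / (1 - r * q) ^ (m + 1)) ≤
        ENNReal.ofReal (C * ψ (1 / (1 - q))) := by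
  obtain ⟨ρ, M, hρ0, hρ, hM, hg⟩ := hψ.exists_growth hp
  rw [hm] at hρ; push_cast at hρ
  obtain ⟨C, hC, hprim⟩ := hψ.exists_logPrimitive_le
  have hsρ : 0 < m + 1 - ρ := by linarith
  refine ⟨C + M / (m + 1 - ρ), by positivity, fun q hq0 hq => ?_⟩
  have hδ : 0 < 1 - q := by linarith
  have hx1 : 1 ≤ 1 / (1 - q) := by rw [le_div_iff₀ hδ]; linarith
  have hψq := hψ.pos _ hx1
  have hsub : Ioo (0 : ℝ) 1 ⊆ Ioc 0 q ∪ Ioo q 1 := by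
    intro r hr
    rcases le_or_gt r q with h | h
    · exact Or.inl ⟨hr.1, h⟩
    · exact Or.inr ⟨h, hr.2⟩
  refine (lintegral_mono_set hsub).trans ((lintegral_union_le _ _ _).trans ?_)
  rw [add_mul, ENNReal.ofReal_add (by positivity) (by positivity)]
  refine add_le_add ?_ ?_
  · refine le_trans ?_ ((hψ.lintegral_inner_le hq0 hq).trans
      (ENNReal.ofReal_le_ofReal (hprim _ hx1)))
    refine setLIntegral_mono' measurableSet_Ioc fun r hr => ENNReal.ofReal_le_ofReal ?_
    have h1 : 0 < 1 - r := by linarith [hr.2]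
    have h2 : 1 - r ≤ 1 - r * q := by nlinarith [hr.1]
    have h3 := hψ.pos (1 / (1 - r)) (by rw [le_div_iff₀ h1]; linarith [hr.1])
    calc (1 - r) ^ m * ψ (1 / (1 - r)) / (1 - r * q) ^ (m + 1) ≤
          (1 - r) ^ m * ψ (1 / (1 - r)) / (1 - r) ^ (m + 1) := by gcongr
      _ = ψ (1 / (1 - r)) / (1 - r) := by rw [pow_succ]; field_simp
  · set K : ℝ := M * (1 - q) ^ (ρ - (m + 1)) * ψ (1 / (1 - q)) with hK
    have hK0 : 0 ≤ K := by positivity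
    calc ∫⁻ r in Ioo q 1, ENNReal.ofReal ((1 - r) ^ m * ψ (1 / (1 - r)) / (1 - r * q) ^ (m + 1))
        ≤ ∫⁻ r in Ioo q 1, ENNReal.ofReal K * ENNReal.ofReal ((1 - r) ^ (m - ρ)) := by
          refine setLIntegral_mono' measurableSet_Ioo fun r hr => ?_
          rw [← ENNReal.ofReal_mul hK0]
          refine ENNReal.ofReal_le_ofReal ?_
          have h1 : 0 < 1 - r := by linarith [hr.2]
          have h2 : 1 - q ≤ 1 - r * q := by nlinarith [hr.2]
          have h3 := hψ.pos (1 / (1 - r)) (by rw [le_div_iff₀ h1]; linarith [hr.1])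
          have h4 := hg (1 / (1 - q)) ((1 - q) / (1 - r)) hx1
            (by rw [le_div_iff₀ h1]; linarith [hr.1])
          rw [show (1 - q) / (1 - r) * (1 / (1 - q)) = 1 / (1 - r) by field_simp] at h4
          calc (1 - r) ^ m * ψ (1 / (1 - r)) / (1 - r * q) ^ (m + 1)
              ≤ (1 - r) ^ m * (M * ((1 - q) / (1 - r)) ^ ρ * ψ (1 / (1 - q))) /
                (1 - q) ^ (m + 1) := by gcongr
            _ = K * (1 - r) ^ (m - ρ) := by
                rw [hK, Real.div_rpow hδ.le h1.le, Real.rpow_sub hδ, Real.rpow_sub h1,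
                  Real.rpow_natCast,
                  show ((m : ℝ) + 1) = ((m + 1 : ℕ) : ℝ) by push_cast; ring, Real.rpow_natCast]
                have := (Real.rpow_pos_of_pos h1 ρ).ne'
                field_simp
      _ = ENNReal.ofReal K * ∫⁻ r in Ioo q 1, ENNReal.ofReal ((1 - r) ^ (m - ρ)) :=
          lintegral_const_mul' _ _ ENNReal.ofReal_ne_top
      _ ≤ ENNReal.ofReal K * ∫⁻ r in Ioc q 1, ENNReal.ofReal ((1 - r) ^ (m - ρ)) := by
          gcongr
          exact Ioo_subset_Ioc_self
      _ = ENNReal.ofReal (M / (m + 1 - ρ) * ψ (1 / (1 - q))) := by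
          rw [lintegral_one_sub_rpow (by linarith) hq.le, ← ENNReal.ofReal_mul hK0, hK]
          congr 1
          rw [show (m : ℝ) - ρ + 1 = -(ρ - (m + 1)) by ring, Real.rpow_neg hδ.le,
            show (m : ℝ) + 1 - ρ = -(ρ - (m + 1)) by ring]
          have := (Real.rpow_pos_of_pos hδ (ρ - (m + 1))).ne'
          field_simp
      _ ≤ _ := le_rfl

/-- The Poisson integral of the constant 1. -/
theorem integral_inv_norm_sq_eq {w : ℂ} (hw : ‖w‖ < 1) :
    ∫ θ in (0 : ℝ)..2 * Real.pi, (‖circleMap 0 1 θ - w‖ ^ 2)⁻¹ = 2 * Real.pi / (1 - ‖w‖ ^ 2) := by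
  have h := DiffContOnCl.circleAverage_poissonKernel_smul' (f := fun _ : ℂ => (1 : ℂ)) (c := 0)
    (R := 1) (w := w) diffContOnCl_const (by simpa using hw)
  have hw2 : 1 - ‖w‖ ^ 2 ≠ 0 := by nlinarith [norm_nonneg w]
  have h' : Real.circleAverage (fun z => (1 - ‖w‖ ^ 2) * (‖z - w‖ ^ 2)⁻¹) 0 1 = 1 := by
    have h1 : ∀ z : ℂ, ((1 - ‖w‖ ^ 2 : ℝ) : ℂ) = 1 - (‖w‖ : ℂ) ^ 2 := by intro z; push_cast; rfl
    rw [Real.circleAverage_def] at h ⊢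
    simp only [sub_zero, norm_circleMap_zero, abs_one, one_pow, Complex.real_smul, mul_one] at h ⊢
    rw [intervalIntegral.integral_ofReal] at h
    simp only [div_eq_mul_inv] at h
    exact_mod_cast h
  rw [Real.circleAverage_def, intervalIntegral.integral_const_mul, smul_eq_mul] at h'
  have := Real.pi_pos
  field_simp at h' ⊢
  linarith

theorem lintegral_inv_norm_sq_eq {w : ℂ} (hw : ‖w‖ < 1) :
    ∫⁻ θ in Ioo (-Real.pi) Real.pi, ENNReal.ofReal ((‖circleMap 0 1 θ - w‖ ^ 2)⁻¹) =
      ENNReal.ofReal (2 * Real.pi / (1 - ‖w‖ ^ 2)) := by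
  have hcont : Continuous fun θ : ℝ => (‖circleMap 0 1 θ - w‖ ^ 2)⁻¹ := by
    refine Continuous.inv₀ (by fun_prop) fun θ => ?_
    have : circleMap 0 1 θ ≠ w := by
      intro h
      have := norm_circleMap_zero 1 θ
      rw [h, abs_one] at this
      linarith
    simpa [sub_eq_zero] using this
  have hper : Function.Periodic (fun θ : ℝ => (‖circleMap 0 1 θ - w‖ ^ 2)⁻¹) (2 * Real.pi) := by
    intro θ
    simp only [periodic_circleMap 0 1 θ]
  rw [← integral_inv_norm_sq_eq hw]
  have := hper.intervalIntegral_add_eq 0 (-Real.pi)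
  rw [zero_add] at this
  rw [this, show -Real.pi + 2 * Real.pi = Real.pi by ring,
    intervalIntegral.integral_of_le (by linarith [Real.pi_pos]),
    setLIntegral_congr Ioo_ae_eq_Ioc,
    ofReal_integral_eq_lintegral_ofReal (hcont.intervalIntegrable _ _).1]
  exact ae_of_all _ fun θ => by positivity

/-- A rotation turns the denominator into |e^{iθ} - rζ|. Of its m + 2 powers, m are estimated by the
minimum 1 - r|ζ|, and the other two form a Poisson kernel. -/
theorem lintegral_angle_le (m : ℕ) {r : ℝ} (hr0 : 0 ≤ r) (hr1 : r < 1) {ζ : ℂ} (hζ : ‖ζ‖ < 1) :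
    ∫⁻ θ in Ioo (-Real.pi) Real.pi, ENNReal.ofReal
      ((‖1 - (starRingEnd ℂ) (circleMap 0 r θ) * ζ‖ ^ (m + 2))⁻¹) ≤
      ENNReal.ofReal (2 * Real.pi * ((1 - r * ‖ζ‖) ^ (m + 1))⁻¹) := by
  have hw : ‖(r : ℂ) * ζ‖ = r * ‖ζ‖ := by
    rw [norm_mul, Complex.norm_real, Real.norm_of_nonneg hr0]
  have hw1 : r * ‖ζ‖ < 1 := by nlinarith [norm_nonneg ζ]
  have hw0 : 0 ≤ r * ‖ζ‖ := by positivity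
  have h1 : 0 < 1 - r * ‖ζ‖ := by linarith
  have heq : ∀ θ : ℝ, ‖1 - (starRingEnd ℂ) (circleMap 0 r θ) * ζ‖ = ‖circleMap 0 1 θ - r * ζ‖ := by
    intro θ
    have hu : circleMap 0 1 θ * (starRingEnd ℂ) (circleMap 0 1 θ) = 1 := by
      rw [Complex.mul_conj', norm_circleMap_zero]; simp
    have hc : circleMap 0 r θ = r * circleMap 0 1 θ := by simp [circleMap]
    rw [hc, map_mul, Complex.conj_ofReal]
    have : circleMap 0 1 θ - r * ζ =
        circleMap 0 1 θ * (1 - r * (starRingEnd ℂ) (circleMap 0 1 θ) * ζ) := by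
      linear_combination (r * ζ) * hu
    rw [this, norm_mul, norm_circleMap_zero, abs_one, one_mul]
  calc _ ≤ ∫⁻ θ in Ioo (-Real.pi) Real.pi, ENNReal.ofReal (((1 - r * ‖ζ‖) ^ m)⁻¹) *
        ENNReal.ofReal ((‖circleMap 0 1 θ - r * ζ‖ ^ 2)⁻¹) := by
        refine lintegral_mono fun θ => ?_
        rw [← ENNReal.ofReal_mul (by positivity), heq θ, ← mul_inv]
        refine ENNReal.ofReal_le_ofReal ?_
        have h2 : 1 - r * ‖ζ‖ ≤ ‖circleMap 0 1 θ - r * ζ‖ := by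
          have := norm_sub_norm_le (circleMap 0 1 θ) (r * ζ)
          rwa [hw, norm_circleMap_zero, abs_one] at this
        have h3 : 0 < ‖circleMap 0 1 θ - r * ζ‖ := by linarith
        rw [pow_add]
        gcongr
    _ = ENNReal.ofReal (((1 - r * ‖ζ‖) ^ m)⁻¹) *
        ENNReal.ofReal (2 * Real.pi / (1 - ‖(r : ℂ) * ζ‖ ^ 2)) := by
        rw [lintegral_const_mul' _ _ ENNReal.ofReal_ne_top,
          lintegral_inv_norm_sq_eq (by rw [hw]; exact hw1)]
    _ ≤ _ := by
        rw [← ENNReal.ofReal_mul (by positivity), hw]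
        refine ENNReal.ofReal_le_ofReal ?_
        have h4 : 1 - r * ‖ζ‖ ≤ 1 - (r * ‖ζ‖) ^ 2 := by nlinarith
        have := Real.pi_pos
        calc ((1 - r * ‖ζ‖) ^ m)⁻¹ * (2 * Real.pi / (1 - (r * ‖ζ‖) ^ 2))
            ≤ ((1 - r * ‖ζ‖) ^ m)⁻¹ * (2 * Real.pi / (1 - r * ‖ζ‖)) := by gcongr
          _ = _ := by rw [pow_succ, mul_inv]; ring

theorem ClassR.exists_area_bound {ψ : ℝ → ℝ} (hψ : ClassR ψ) (hp : FinitePolyaOrder ψ)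
    {m : ℕ} (hm : genus ψ = m + 1) :
    ∃ C : ℝ, 0 < C ∧ ∀ ζ : ℂ, ‖ζ‖ < 1 →
      ∫⁻ w in Metric.ball (0 : ℂ) 1, ENNReal.ofReal ((1 - ‖w‖) ^ m * ψ (1 / (1 - ‖w‖)) *
        (‖1 - (starRingEnd ℂ) w * ζ‖ ^ (m + 2))⁻¹) ≤ ENNReal.ofReal (C * ψ (1 / (1 - ‖ζ‖))) := by
  obtain ⟨C, hC, hrad⟩ := hψ.exists_radial_bound hp hm
  have hpi := Real.pi_pos
  refine ⟨2 * Real.pi * C, by positivity, fun ζ hζ => ?_⟩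
  rw [← lintegral_indicator Metric.isOpen_ball.measurableSet,
    ← Complex.lintegral_comp_polarCoord_symm]
  have htgt : polarCoord.target = Ioi (0 : ℝ) ×ˢ Ioo (-Real.pi) Real.pi := rfl
  rw [htgt, Measure.volume_eq_prod, ← Measure.prod_restrict]
  -- This half of Tonelli requires no measurability of the integrand.
  refine (lintegral_prod_le _).trans ?_
  set G : ℝ → ℝ≥0∞ := fun r =>
    ENNReal.ofReal ((1 - r) ^ m * ψ (1 / (1 - r)) / (1 - r * ‖ζ‖) ^ (m + 1)) with hG
  calc _ ≤ ∫⁻ r in Ioi (0 : ℝ), (Iio (1 : ℝ)).indicator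
            (fun r => ENNReal.ofReal (2 * Real.pi) * G r) r := by
        refine setLIntegral_mono' measurableSet_Ioi fun r hr => ?_
        have hr0 : 0 < r := hr
        have hcm : ∀ θ : ℝ, Complex.polarCoord.symm (r, θ) = circleMap 0 r θ := by
          intro θ
          rw [Complex.polarCoord_symm_apply, circleMap, Complex.exp_mul_I]
          push_cast; ring
        have hnorm : ∀ θ : ℝ, ‖circleMap 0 r θ‖ = r := by
          intro θ; rw [norm_circleMap_zero, abs_of_pos hr0]
        rcases lt_or_ge r 1 with h1 | h1
        · rw [indicator_of_mem (show r ∈ Iio (1:ℝ) from h1)]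
          have h1r : 0 < 1 - r := by linarith
          have hψr := hψ.pos (1 / (1 - r)) (by rw [le_div_iff₀ h1r]; linarith)
          calc _ ≤ ∫⁻ θ in Ioo (-Real.pi) Real.pi,
                ENNReal.ofReal ((1 - r) ^ m * ψ (1 / (1 - r))) *
                ENNReal.ofReal ((‖1 - (starRingEnd ℂ) (circleMap 0 r θ) * ζ‖ ^ (m + 2))⁻¹) := by
                refine lintegral_mono fun θ => ?_
                rw [hcm, indicator_of_mem (by simp [abs_of_pos hr0, h1]), smul_eq_mul]
                rw [hnorm, ENNReal.ofReal_mul (by positivity)]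
                -- The polar Jacobian r ≤ 1 is discarded.
                exact mul_le_of_le_one_left (zero_le) (ENNReal.ofReal_le_one.2 h1.le)
            _ ≤ ENNReal.ofReal ((1 - r) ^ m * ψ (1 / (1 - r))) *
                ENNReal.ofReal (2 * Real.pi * ((1 - r * ‖ζ‖) ^ (m + 1))⁻¹) := by
                rw [lintegral_const_mul' _ _ ENNReal.ofReal_ne_top]
                gcongr
                exact lintegral_angle_le m hr0.le h1 hζ
            _ = _ := by
                rw [← ENNReal.ofReal_mul (by positivity), hG]
                simp only
                rw [← ENNReal.ofReal_mul (by positivity)]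
                congr 1; ring
        · rw [indicator_of_notMem (by simpa using h1)]
          refine le_of_eq ?_
          rw [lintegral_eq_zero_of_ae_eq_zero]
          refine ae_of_all _ fun θ => ?_
          simp only [hcm]
          rw [indicator_of_notMem]
          · simp
          · simp only [Metric.mem_ball, dist_zero_right, hnorm]; linarith
    _ = ENNReal.ofReal (2 * Real.pi) * ∫⁻ r in Ioo (0 : ℝ) 1, G r := by
        rw [lintegral_indicator measurableSet_Iio, Measure.restrict_restrict measurableSet_Iio,
          lintegral_const_mul' _ _ ENNReal.ofReal_ne_top, inter_comm, Ioi_inter_Iio]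
    _ ≤ ENNReal.ofReal (2 * Real.pi) * ENNReal.ofReal (C * ψ (1 / (1 - ‖ζ‖))) := by
        gcongr
        exact hrad ‖ζ‖ (norm_nonneg _) hζ
    _ = _ := by rw [← ENNReal.ofReal_mul (by positivity)]; congr 1; ring

/-! ### The sum of |A_k|^(s+1) under the density condition -/

theorem count_eq_tsum {ι : Type*} (z : ι → ℂ) (ζ : ℂ) (t : ℝ) :
    ((count z ζ t : ℕ∞) : ℝ≥0∞) = ∑' k, {k | ‖z k - ζ‖ ≤ t}.indicator (fun _ => (1 : ℝ≥0∞)) k := by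
  rw [count, ← ENNReal.tsum_set_one, tsum_subtype _ fun _ => (1 : ℝ≥0∞)]

/-- On the disc 1-|w| ≥ h/2 and |1 - w̄ζ| ≤ 2D, so the integrand is nearly constant. The factor 16
offsets the area, at least (h/4)², and 4^(m+1) = 2^m · 2^(m+2) offsets the two comparisons. -/
theorem ofReal_le_lintegral_disc {a ζ : ℂ} (ha : ‖a‖ < 1) (hζ : ‖ζ‖ < 1) (m : ℕ) :
    ENNReal.ofReal (((1 - ‖a‖) / ‖1 - (starRingEnd ℂ) a * ζ‖) ^ (m + 2)) ≤
      ∫⁻ w in Metric.closedBall a ((1 - ‖a‖) / 4), ENNReal.ofReal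
        (16 * 4 ^ (m + 1) * ((1 - ‖w‖) ^ m * (‖1 - (starRingEnd ℂ) w * ζ‖ ^ (m + 2))⁻¹)) := by
  set h := 1 - ‖a‖ with hh
  set D := ‖1 - (starRingEnd ℂ) a * ζ‖ with hD
  have hh0 : 0 < h := by linarith
  have hhD : h ≤ D := one_sub_norm_le_norm_one_sub hζ.le
  have hD0 : 0 < D := by linarith
  calc ENNReal.ofReal ((h / D) ^ (m + 2))
      ≤ ENNReal.ofReal (16 * (h ^ m / D ^ (m + 2))) * (ENNReal.ofReal (h / 4) ^ 2 * 1) := by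
        rw [mul_one, ← ENNReal.ofReal_pow (by positivity), ← ENNReal.ofReal_mul (by positivity)]
        refine ENNReal.ofReal_le_ofReal (le_of_eq ?_)
        rw [div_pow, pow_add h]; field_simp; norm_num
    _ ≤ ENNReal.ofReal (16 * (h ^ m / D ^ (m + 2))) * volume (Metric.closedBall a (h / 4)) := by
        rw [Complex.volume_closedBall]
        gcongr
        have : (1 : NNReal) ≤ NNReal.pi := by
          rw [← NNReal.coe_le_coe]; simp only [NNReal.coe_one, NNReal.coe_real_pi]
          linarith [Real.pi_gt_three]
        exact_mod_cast this
    _ = ∫⁻ _ in Metric.closedBall a (h / 4), ENNReal.ofReal (16 * (h ^ m / D ^ (m + 2))) := by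
        rw [setLIntegral_const]
    _ ≤ _ := by
        refine setLIntegral_mono' Metric.isClosed_closedBall.measurableSet fun w hw => ?_
        refine ENNReal.ofReal_le_ofReal ?_
        rw [mem_closedBall_iff_norm] at hw
        have h1 : ‖w‖ - ‖a‖ ≤ ‖w - a‖ := norm_sub_norm_le _ _
        have h2 : ‖1 - (starRingEnd ℂ) w * ζ‖ ≤ 2 * D := by
          have : 1 - (starRingEnd ℂ) w * ζ =
              (1 - (starRingEnd ℂ) a * ζ) - (starRingEnd ℂ) (w - a) * ζ := by
            rw [map_sub]; ring
          rw [this]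
          refine (norm_sub_le _ _).trans ?_
          rw [norm_mul, RCLike.norm_conj]
          have := mul_le_of_le_one_right (norm_nonneg (w - a)) hζ.le
          linarith
        have h3 : h / 2 ≤ 1 - ‖w‖ := by linarith
        have h4 : 0 < ‖1 - (starRingEnd ℂ) w * ζ‖ := by
          have := one_sub_norm_le_norm_one_sub (a := w) hζ.le
          linarith
        calc 16 * (h ^ m / D ^ (m + 2))
            = 16 * 4 ^ (m + 1) * ((h / 2) ^ m * ((2 * D) ^ (m + 2))⁻¹) := by
              rw [div_pow, mul_pow, show (4 : ℝ) = 2 * 2 by norm_num, mul_pow, pow_add 2 m 2,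
                pow_succ (2 : ℝ) m]
              field_simp
          _ ≤ _ := by
            have h5 : 0 ≤ 1 - ‖w‖ := by linarith
            gcongr

theorem CountBound.exists_tsum_le {ι : Type*} [Countable ι] {z : ι → ℂ} (hdisc : ∀ n, ‖z n‖ < 1)
    {ψ : ℝ → ℝ} (hψ : ClassR ψ) (hp : FinitePolyaOrder ψ) (hc : CountBound z ψ) :
    ∃ C : ℝ, 0 < C ∧ ∀ ζ : ℂ, ‖ζ‖ < 1 →
      ∑' k, ENNReal.ofReal (((1 - ‖z k‖) / ‖1 - (starRingEnd ℂ) (z k) * ζ‖) ^ (genus ψ + 1)) ≤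
        ENNReal.ofReal (C * ψ (1 / (1 - ‖ζ‖))) := by
  obtain ⟨m, hm⟩ : ∃ m, genus ψ = m + 1 := ⟨_, rfl⟩
  obtain ⟨C, hC, harea⟩ := hψ.exists_area_bound hp hm
  obtain ⟨C', hC', hcount⟩ := hc
  rw [hm]
  refine ⟨C' * (16 * 4 ^ (m + 1)) * C, by positivity, fun ζ hζ => ?_⟩
  set g : ℂ → ℝ≥0∞ := fun w => ENNReal.ofReal
    (16 * 4 ^ (m + 1) * ((1 - ‖w‖) ^ m * (‖1 - (starRingEnd ℂ) w * ζ‖ ^ (m + 2))⁻¹)) with hg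
  have hgm : Measurable g := by
    refine ENNReal.measurable_ofReal.comp ?_
    have h1 : Continuous fun w : ℂ => ‖1 - (starRingEnd ℂ) w * ζ‖ ^ (m + 2) := by fun_prop
    have h2 : Continuous fun w : ℂ => (1 - ‖w‖) ^ m := by fun_prop
    exact (h2.measurable.mul h1.measurable.inv).const_mul _
  calc _ ≤ ∑' k, ∫⁻ w in Metric.closedBall (z k) ((1 - ‖z k‖) / 4), g w :=
        ENNReal.tsum_le_tsum fun k => ofReal_le_lintegral_disc (hdisc k) hζ m
    _ = ∫⁻ w, ∑' k, (Metric.closedBall (z k) ((1 - ‖z k‖) / 4)).indicator g w := by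
        rw [lintegral_tsum fun k => (hgm.indicator Metric.isClosed_closedBall.measurableSet).aemeasurable]
        simp_rw [lintegral_indicator Metric.isClosed_closedBall.measurableSet]
    _ ≤ ∫⁻ w, (Metric.ball (0 : ℂ) 1).indicator (fun w => ENNReal.ofReal (C' * (16 * 4 ^ (m + 1))) *
          ENNReal.ofReal ((1 - ‖w‖) ^ m * ψ (1 / (1 - ‖w‖)) *
            (‖1 - (starRingEnd ℂ) w * ζ‖ ^ (m + 2))⁻¹)) w := by
        refine lintegral_mono fun w => ?_
        -- Hence the number of discs that contain w is at most n_w((1-|w|)/2).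
        have hmem : ∀ k, w ∈ Metric.closedBall (z k) ((1 - ‖z k‖) / 4) →
            ‖w‖ < 1 ∧ ‖z k - w‖ ≤ (1 - ‖w‖) / 2 := by
          intro k hk
          rw [mem_closedBall_iff_norm] at hk
          have h1 : ‖w‖ - ‖z k‖ ≤ ‖w - z k‖ := norm_sub_norm_le _ _
          have h2 := hdisc k
          rw [norm_sub_rev]
          constructor <;> linarith
        by_cases hw : w ∈ Metric.ball (0 : ℂ) 1
        · have hw1 : ‖w‖ < 1 := by simpa using hw
          have h0 : 0 < 1 - ‖w‖ := by linarith
          have hψw := hψ.pos (1 / (1 - ‖w‖))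
            (by rw [le_div_iff₀ h0]; linarith [norm_nonneg w])
          rw [indicator_of_mem hw]
          calc ∑' k, (Metric.closedBall (z k) ((1 - ‖z k‖) / 4)).indicator g w
              ≤ ∑' k, {k | ‖z k - w‖ ≤ (1 - ‖w‖) / 2}.indicator (fun _ => (1 : ℝ≥0∞)) k * g w := by
                refine ENNReal.tsum_le_tsum fun k => ?_
                by_cases hk : w ∈ Metric.closedBall (z k) ((1 - ‖z k‖) / 4)
                · rw [indicator_of_mem hk, indicator_of_mem (by exact (hmem k hk).2), one_mul]
                · rw [indicator_of_notMem hk]; exact zero_le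
            _ ≤ ENNReal.ofReal (C' * ψ (1 / (1 - ‖w‖))) * g w := by
                rw [ENNReal.tsum_mul_right, ← count_eq_tsum]
                exact mul_le_mul_left (hcount w hw1) _
            _ = _ := by
                rw [hg, ← ENNReal.ofReal_mul (by positivity), ← ENNReal.ofReal_mul (by positivity)]
                congr 1; ring
        · rw [indicator_of_notMem hw]
          refine le_of_eq (ENNReal.tsum_eq_zero.2 fun k => indicator_of_notMem (fun hk => hw ?_) _)
          simpa using (hmem k hk).1
    _ ≤ _ := by
        rw [lintegral_indicator Metric.isOpen_ball.measurableSet,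
          lintegral_const_mul' _ _ ENNReal.ofReal_ne_top, mul_assoc (C' * _),
          ENNReal.ofReal_mul (p := C' * (16 * 4 ^ (m + 1))) (by positivity)]
        exact mul_le_mul_right (harea ζ hζ) _

/-- Convergence and size of the sum `∑ |A_k (ζ)| ^ (s + 1)`. -/
theorem CountBound.exists_kernelA_bound {ι : Type*} [Countable ι] {z : ι → ℂ}
    (hdisc : ∀ n, ‖z n‖ < 1) {ψ : ℝ → ℝ} (hψ : ClassR ψ) (hp : FinitePolyaOrder ψ)
    (hc : CountBound z ψ) :
    ∃ C : ℝ, 0 < C ∧ ∀ ζ : ℂ, ‖ζ‖ < 1 →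
      Summable (fun k => ‖kernelA (z k) ζ‖ ^ (genus ψ + 1)) ∧
      ∑' k, ‖kernelA (z k) ζ‖ ^ (genus ψ + 1) ≤ C * ψ (1 / (1 - ‖ζ‖)) := by
  obtain ⟨C, hC, h⟩ := hc.exists_tsum_le hdisc hψ hp
  refine ⟨2 ^ (genus ψ + 1) * C, by positivity, fun ζ hζ => ?_⟩
  have h0 : 0 < 1 - ‖ζ‖ := by linarith
  have hψw := hψ.pos (1 / (1 - ‖ζ‖)) (by rw [le_div_iff₀ h0]; linarith [norm_nonneg ζ])
  set f : ι → ℝ := fun k => ((1 - ‖z k‖) / ‖1 - (starRingEnd ℂ) (z k) * ζ‖) ^ (genus ψ + 1) with hf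
  have hf0 : ∀ k, 0 ≤ f k := fun k =>
    pow_nonneg (div_nonneg (by linarith [hdisc k]) (norm_nonneg _)) _
  have hfs : Summable f := by
    have := ENNReal.summable_toReal (ne_top_of_le_ne_top ENNReal.ofReal_ne_top (h ζ hζ))
    refine this.congr fun k => ENNReal.toReal_ofReal (hf0 k)
  have hle : ∀ k, ‖kernelA (z k) ζ‖ ^ (genus ψ + 1) ≤ 2 ^ (genus ψ + 1) * f k := by
    intro k
    rw [hf]; simp only
    rw [← mul_pow]
    gcongr
    exact norm_kernelA_le (hdisc k).le ζ
  have hs : Summable (fun k => ‖kernelA (z k) ζ‖ ^ (genus ψ + 1)) :=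
    Summable.of_nonneg_of_le (fun k => by positivity) hle (hfs.mul_left _)
  refine ⟨hs, (hs.tsum_le_tsum hle (hfs.mul_left _)).trans ?_⟩
  rw [tsum_mul_left, mul_assoc]
  gcongr
  rw [← ENNReal.ofReal_le_ofReal_iff (by positivity), ENNReal.ofReal_tsum_of_nonneg hf0 hfs]
  exact h ζ hζ

theorem CountBound.summable {ι : Type*} [Countable ι] {z : ι → ℂ}
    (hdisc : ∀ n, ‖z n‖ < 1) {ψ : ℝ → ℝ} (hψ : ClassR ψ) (hp : FinitePolyaOrder ψ)
    (hc : CountBound z ψ) : Summable (fun n => (1 - ‖z n‖) ^ (genus ψ + 1)) := by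
  obtain ⟨C, hC, h⟩ := hc.exists_kernelA_bound hdisc hψ hp
  refine Summable.of_nonneg_of_le (fun k => pow_nonneg (by linarith [hdisc k]) _) (fun k => ?_)
    (h 0 (by simp)).1
  have := le_norm_kernelA (hdisc k).le 0
  simp only [mul_zero, sub_zero, norm_one, div_one] at this
  have h1 : 0 ≤ 1 - ‖z k‖ := by linarith [hdisc k]
  gcongr

/-! ### The logarithmic counting function at a node -/

theorem lintegral_Icc_inv {d r : ℝ} (hd : 0 < d) (hdr : d ≤ r) :
    ∫⁻ t in Icc d r, (ENNReal.ofReal t)⁻¹ = ENNReal.ofReal (Real.log (r / d)) := by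
  rw [← integral_inv_of_pos hd (hd.trans_le hdr), intervalIntegral.integral_of_le hdr,
    ← integral_Icc_eq_integral_Ioc, ofReal_integral_eq_lintegral_ofReal]
  · refine setLIntegral_congr_fun measurableSet_Icc fun t ht => ?_
    rw [ENNReal.ofReal_inv_of_pos (hd.trans_le ht.1)]
  · refine ContinuousOn.integrableOn_Icc (continuousOn_inv₀.mono fun t ht => ?_)
    simpa using (hd.trans_le ht.1).ne'
  · refine (ae_restrict_iff' measurableSet_Icc).2 (ae_of_all _ fun t ht => ?_)
    exact inv_nonneg.2 (hd.le.trans ht.1)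

open Classical in
/-- The contribution of the node `z k` to `N_{z_n} (r)`. -/
noncomputable def nodeLog {ι : Type*} (z : ι → ℂ) (n : ι) (r : ℝ) (k : ι) : ℝ :=
  if k = n then 0 else if ‖z k - z n‖ ≤ r then Real.log (r / ‖z k - z n‖) else 0

theorem nodeLog_nonneg {ι : Type*} (z : ι → ℂ) (n : ι) (r : ℝ) (k : ι) : 0 ≤ nodeLog z n r k := by
  unfold nodeLog
  split_ifs with h1 h2
  · exact le_rfl
  · rcases (norm_nonneg (z k - z n)).eq_or_lt with h | h
    · simp [← h]
    · exact Real.log_nonneg ((one_le_div h).2 h2)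
  · exact le_rfl

theorem count_sub_one_eq_tsum {ι : Type*} (z : ι → ℂ) (n : ι) {t : ℝ} (ht : 0 ≤ t) :
    ((count z (z n) t - 1 : ℕ∞) : ℝ≥0∞) =
      ∑' k, ({k | ‖z k - z n‖ ≤ t} \ {n}).indicator (fun _ => (1 : ℝ≥0∞)) k := by
  rw [count, ← Set.encard_sdiff_singleton_of_mem (show n ∈ {k | ‖z k - z n‖ ≤ t} by simpa using ht),
    ← ENNReal.tsum_set_one, tsum_subtype _ fun _ => (1 : ℝ≥0∞)]

/-- The truncated subtraction of 1 removes exactly the node z_n. Any other node is counted from t =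
|z_k - z_n| on, and dt/t integrates to ln(r/|z_k - z_n|). -/
theorem logCount_node {ι : Type*} [Countable ι] {z : ι → ℂ} (hz : Function.Injective z) (n : ι)
    (r : ℝ) : logCount z (z n) r = ∑' k, ENNReal.ofReal (nodeLog z n r k) := by
  have hmeas : ∀ d : ℝ, Measurable ((Ici d).indicator fun t => (ENNReal.ofReal t)⁻¹) := fun d =>
    (ENNReal.measurable_ofReal.inv).indicator measurableSet_Ici
  classical
  calc logCount z (z n) r = ∫⁻ t in Ioc 0 r, ∑' k, (if k = n then 0 else
        (Ici ‖z k - z n‖).indicator (fun t => (ENNReal.ofReal t)⁻¹) t) := by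
        refine setLIntegral_congr_fun measurableSet_Ioc fun t ht => ?_
        rw [count_sub_one_eq_tsum z n ht.1.le, div_eq_mul_inv, ← ENNReal.tsum_mul_right]
        refine tsum_congr fun k => ?_
        by_cases hk : k = n
        · simp [hk]
        · by_cases hd : ‖z k - z n‖ ≤ t <;> simp [hk, hd]
    _ = ∑' k, ∫⁻ t in Ioc 0 r, (if k = n then 0 else
        (Ici ‖z k - z n‖).indicator (fun t => (ENNReal.ofReal t)⁻¹) t) := by
        refine lintegral_tsum fun k => ?_
        split_ifs
        · exact aemeasurable_const
        · exact (hmeas _).aemeasurable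
    _ = _ := by
        refine tsum_congr fun k => ?_
        unfold nodeLog
        split_ifs with h1 h2
        · simp
        · have hd : 0 < ‖z k - z n‖ := norm_pos_iff.2 (sub_ne_zero.2 fun h => h1 (hz h))
          rw [lintegral_indicator measurableSet_Ici, Measure.restrict_restrict measurableSet_Ici,
            ← lintegral_Icc_inv hd h2]
          congr 2
          ext t
          simp only [mem_inter_iff, mem_Ici, mem_Ioc, mem_Icc]
          constructor
          · rintro ⟨a, -, b⟩; exact ⟨a, b⟩
          · rintro ⟨a, b⟩; exact ⟨a, hd.trans_le a, b⟩
        · rw [lintegral_indicator measurableSet_Ici, Measure.restrict_restrict measurableSet_Ici,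
            show Ici ‖z k - z n‖ ∩ Ioc 0 r = ∅ from ?_]
          · simp
          · ext t
            simp only [mem_inter_iff, mem_Ici, mem_Ioc, mem_empty_iff_false, iff_false]
            rintro ⟨a, -, b⟩; exact h2 (a.trans b)

theorem CountBound.finite {ι : Type*} {z : ι → ℂ} {ψ : ℝ → ℝ} (hc : CountBound z ψ) {ζ : ℂ}
    (hζ : ‖ζ‖ < 1) : {k | ‖z k - ζ‖ ≤ (1 - ‖ζ‖) / 2}.Finite := by
  obtain ⟨C, -, h⟩ := hc
  have h1 := ne_top_of_le_ne_top ENNReal.ofReal_ne_top (h ζ hζ)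
  rw [← Set.encard_ne_top_iff]
  intro h2
  rw [count, h2] at h1
  simp at h1

/-- Only finitely many nodes lie in |z| ≤ 1/2. The bound is needed because |1 - A_k| contains the
factor |z_k|. -/
theorem CountBound.exists_le_norm {ι : Type*} {z : ι → ℂ} (hne : ∀ n, z n ≠ 0) {ψ : ℝ → ℝ}
    (hc : CountBound z ψ) : ∃ η : ℝ, 0 < η ∧ ∀ k, η ≤ ‖z k‖ := by
  have hfin := hc.finite (ζ := 0) (by simp)
  simp only [sub_zero, norm_zero] at hfin
  rcases Set.eq_empty_or_nonempty {k | ‖z k‖ ≤ 1 / 2} with h | h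
  · refine ⟨1 / 2, by norm_num, fun k => ?_⟩
    by_contra hk
    have : k ∈ {k | ‖z k‖ ≤ 1 / 2} := (not_le.1 hk).le
    rw [h] at this
    exact this.elim
  · obtain ⟨j, hj, hmin⟩ := Set.exists_min_image _ (fun k => ‖z k‖) hfin h
    refine ⟨‖z j‖, norm_pos_iff.2 (hne j), fun k => ?_⟩
    by_cases hk : ‖z k‖ ≤ 1 / 2
    · exact hmin k hk
    · exact hj.trans (not_le.1 hk).le

/-! ### The derivative of the canonical product at a node -/

/-- At a zero, continuity of the cofactor suffices, so the infinite product never has to be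
differentiated. -/
theorem hasDerivAt_sub_mul {H : ℂ → ℂ} {a : ℂ} (hH : ContinuousAt H a) :
    HasDerivAt (fun w => (w - a) * H w) (H a) a := by
  rw [hasDerivAt_iff_tendsto_slope]
  refine (hH.tendsto.mono_left nhdsWithin_le_nhds).congr' ?_
  filter_upwards [self_mem_nhdsWithin] with w hw
  have : w - a ≠ 0 := sub_ne_zero.2 hw
  simp [slope_def_field, this]

theorem continuousAt_kernelA {a ζ : ℂ} (ha : ‖a‖ < 1) (hζ : ‖ζ‖ ≤ 1) :
    ContinuousAt (kernelA a) ζ := by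
  unfold kernelA
  exact ContinuousAt.div continuousAt_const (by fun_prop) (one_sub_conj_mul_ne_zero ha hζ)

theorem continuousAt_primaryFactor_kernelA (s : ℕ) {a ζ : ℂ} (ha : ‖a‖ < 1) (hζ : ‖ζ‖ ≤ 1) :
    ContinuousAt (fun w => primaryFactor (kernelA a w) s) ζ := by
  simp only [primaryFactor_eq]
  have h := continuousAt_kernelA ha hζ
  exact (continuousAt_const.sub h).mul
    (((continuous_logPoly s).continuousAt.comp h).cexp)

section Product

open Classical in
/-- The canonical product with the factor of the node `z n` removed. -/
noncomputable def reducedProduct {ι : Type*} (z : ι → ℂ) (s : ℕ) (n : ι) (w : ℂ) : ℂ :=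
  ∏' k, if k = n then 1 else primaryFactor (kernelA (z k) w) s

variable {ι : Type*} {z : ι → ℂ} {s : ℕ}

open Classical in
-- Weierstrass M-test: |A_k(w)| ≤ 2(1-|z_k|)/(1-R) on the ball of radius R < 1.
theorem hasProdLocallyUniformlyOn_reducedProduct (hdisc : ∀ n, ‖z n‖ < 1)
    (hsum : Summable (fun n => (1 - ‖z n‖) ^ (s + 1))) (n : ι) {R : ℝ} (hR : R < 1) :
    HasProdLocallyUniformlyOn (fun k w => if k = n then 1 else primaryFactor (kernelA (z k) w) s)
      (reducedProduct z s n) (Metric.ball 0 R) := by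
  obtain ⟨C, hC, hE⟩ := exists_norm_primaryFactor_sub_one_le s
  have h := Summable.hasProdLocallyUniformlyOn_one_add (K := Metric.ball (0 : ℂ) R)
    (f := fun k w => (if k = n then 1 else primaryFactor (kernelA (z k) w) s) - 1)
    (u := fun k => C * (2 / (1 - R)) ^ (s + 1) * (1 - ‖z k‖) ^ (s + 1))
    Metric.isOpen_ball (hsum.mul_left _) ?_ ?_
  · simp only [add_sub_cancel] at h
    exact h
  · refine Eventually.of_forall fun k w hw => ?_
    have hk : 0 < 1 - ‖z k‖ := by linarith [hdisc k]
    have hwR : ‖w‖ < R := by simpa using hw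
    have hR1 : 0 < 1 - R := by linarith
    split_ifs
    · simp only [sub_self, norm_zero]; positivity
    · refine (hE _ (norm_kernelA_le_two (hdisc k) (by linarith))).trans ?_
      rw [mul_assoc, ← mul_pow]
      gcongr
      refine (norm_kernelA_le (hdisc k).le w).trans ?_
      have := one_sub_norm_le_norm_one_sub' (a := z k) (ζ := w) (hdisc k).le
      rw [div_mul_eq_mul_div, ← mul_div_assoc]
      gcongr
      linarith
  · intro k w hw
    have hwR : ‖w‖ < R := by simpa using hw
    refine ContinuousAt.continuousWithinAt ?_
    by_cases hk : k = n
    · simp only [hk, if_true]; exact continuousAt_const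
    · simp only [hk, if_false]
      exact (continuousAt_primaryFactor_kernelA s (hdisc k) (by linarith)).sub continuousAt_const

open Classical in
theorem multipliable_reducedProduct (hdisc : ∀ n, ‖z n‖ < 1)
    (hsum : Summable (fun n => (1 - ‖z n‖) ^ (s + 1))) (n : ι) {w : ℂ} (hw : ‖w‖ < 1) :
    Multipliable (fun k => if k = n then 1 else primaryFactor (kernelA (z k) w) s) := by
  obtain ⟨R, h1, h2⟩ := exists_between hw
  exact ((hasProdLocallyUniformlyOn_reducedProduct hdisc hsum n h2).hasProd
    (by simpa using h1)).multipliable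

theorem continuousAt_reducedProduct (hdisc : ∀ n, ‖z n‖ < 1)
    (hsum : Summable (fun n => (1 - ‖z n‖) ^ (s + 1))) (n : ι) {w : ℂ} (hw : ‖w‖ < 1) :
    ContinuousAt (reducedProduct z s n) w := by
  classical
  obtain ⟨R, h1, h2⟩ := exists_between hw
  have h := hasProdLocallyUniformlyOn_reducedProduct hdisc hsum n h2
  refine (TendstoLocallyUniformlyOn.continuousOn h ?_).continuousAt
    (Metric.isOpen_ball.mem_nhds (by simpa using h1))
  refine Eventually.frequently (Eventually.of_forall fun S => ?_)
  refine continuousOn_finsetProd _ fun k _ => ?_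
  intro x hx
  have hxR : ‖x‖ < R := by simpa using hx
  refine ContinuousAt.continuousWithinAt ?_
  by_cases hk : k = n
  · simp only [hk, if_true]; exact continuousAt_const
  · simp only [hk, if_false]
    exact continuousAt_primaryFactor_kernelA s (hdisc k) (by linarith)

theorem canonicalProduct_eq (hdisc : ∀ n, ‖z n‖ < 1)
    (hsum : Summable (fun n => (1 - ‖z n‖) ^ (s + 1))) (n : ι) {w : ℂ} (hw : ‖w‖ < 1) :
    canonicalProduct z s w = primaryFactor (kernelA (z n) w) s * reducedProduct z s n w := by
  classical
  refine Multipliable.tprod_eq_mul_tprod_ite' n ?_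
  convert multipliable_reducedProduct hdisc hsum n hw with k
  simp [Function.update_apply]

/-- The factor 1 - A_n(w) = z̄_n(z_n - w)/(1 - z̄_n w) supplies the simple zero, and A_n(z_n) = 1
gives the argument of `logPoly`. -/
theorem hasDerivAt_canonicalProduct (hdisc : ∀ n, ‖z n‖ < 1)
    (hsum : Summable (fun n => (1 - ‖z n‖) ^ (s + 1))) (n : ι) :
    HasDerivAt (canonicalProduct z s) (-(starRingEnd ℂ) (z n) / (1 - (starRingEnd ℂ) (z n) * z n) *
      Complex.exp (logPoly s 1) * reducedProduct z s n (z n)) (z n) := by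
  have hcont : ContinuousAt (fun w => -(starRingEnd ℂ) (z n) / (1 - (starRingEnd ℂ) (z n) * w) *
      Complex.exp (logPoly s (kernelA (z n) w)) * reducedProduct z s n w) (z n) := by
    refine ContinuousAt.mul (ContinuousAt.mul ?_ ?_) (continuousAt_reducedProduct hdisc hsum n (hdisc n))
    · exact ContinuousAt.div continuousAt_const (by fun_prop)
        (one_sub_conj_mul_ne_zero (hdisc n) (hdisc n).le)
    · exact ((continuous_logPoly s).continuousAt.comp
        (continuousAt_kernelA (hdisc n) (hdisc n).le)).cexp
  have h := hasDerivAt_sub_mul hcont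
  rw [kernelA_self (hdisc n)] at h
  refine h.congr_of_eventuallyEq ?_
  have hball : Metric.ball (0 : ℂ) 1 ∈ nhds (z n) :=
    Metric.isOpen_ball.mem_nhds (by simpa using hdisc n)
  filter_upwards [hball] with w hw
  have hw1 : ‖w‖ < 1 := by simpa using hw
  rw [canonicalProduct_eq hdisc hsum n hw1, primaryFactor_eq, one_sub_kernelA (hdisc n) hw1.le]
  ring

theorem norm_deriv_canonicalProduct (hdisc : ∀ n, ‖z n‖ < 1)
    (hsum : Summable (fun n => (1 - ‖z n‖) ^ (s + 1))) (n : ι) :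
    (1 - ‖z n‖) * ‖deriv (canonicalProduct z s) (z n)‖ =
      ‖z n‖ / (1 + ‖z n‖) * Real.exp (logPoly s 1).re * ‖reducedProduct z s n (z n)‖ := by
  have h1 : 0 < 1 - ‖z n‖ := by linarith [hdisc n]
  have h2 : ‖1 - (starRingEnd ℂ) (z n) * z n‖ = (1 - ‖z n‖) * (1 + ‖z n‖) := by
    rw [mul_comm, Complex.mul_conj', ← Complex.ofReal_pow, ← Complex.ofReal_one,
      ← Complex.ofReal_sub, Complex.norm_real, Real.norm_of_nonneg]
    · ring
    · nlinarith [norm_nonneg (z n)]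
  have h3 : 0 < 1 + ‖z n‖ := by positivity
  rw [(hasDerivAt_canonicalProduct hdisc hsum n).deriv, norm_mul, norm_mul, norm_div, norm_neg,
    RCLike.norm_conj, Complex.norm_exp, h2]
  field_simp

end Product

/-! ### Comparison of P' with N at a node -/

theorem one_le_one_div_one_sub_norm {ζ : ℂ} (hζ : ‖ζ‖ < 1) : 1 ≤ 1 / (1 - ‖ζ‖) := by
  rw [le_div_iff₀ (by linarith)]; linarith [norm_nonneg ζ]

/-- Under the density condition, `N_{z_n} ((1 - |z_n|) / 2)` equals
`-ln ((1 - |z_n|) |P' (z_n)|)` up to an error of size `O (ψ (1 / (1 - |z_n|)))`. -/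
theorem CountBound.exists_abs_log_deriv_add_logCount_le {ι : Type*} [Countable ι] {z : ι → ℂ}
    (hz : Function.Injective z) (hdisc : ∀ n, ‖z n‖ < 1) (hne : ∀ n, z n ≠ 0) {ψ : ℝ → ℝ}
    (hψ : ClassR ψ) (hp : FinitePolyaOrder ψ) (hc : CountBound z ψ) :
    ∃ C : ℝ, 0 < C ∧ ∀ n, ∃ Λ : ℝ, 0 ≤ Λ ∧
      logCount z (z n) ((1 - ‖z n‖) / 2) = ENNReal.ofReal Λ ∧
      |Real.log ((1 - ‖z n‖) * ‖deriv (canonicalProduct z (genus ψ)) (z n)‖) + Λ| ≤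
        C * ψ (1 / (1 - ‖z n‖)) := by
  classical
  have hsum := hc.summable hdisc hψ hp
  obtain ⟨η, hη, hηz⟩ := hc.exists_le_norm hne
  set s := genus ψ with hs
  obtain ⟨B, hB, hpt⟩ := exists_abs_log_norm_primaryFactor_add_le s hη
  obtain ⟨C, hC, hA⟩ := hc.exists_kernelA_bound hdisc hψ hp
  have hψ1 := hψ.pos 1 le_rfl
  -- This bounds the logarithm of the explicit factor |z_n|/(1+|z_n|) · exp(Re `logPoly s 1`).
  -- Division by ψ(1) ≤ ψ then makes it a multiple of ψ.
  set c₀ : ℝ := |Real.log η| + Real.log 2 + |(logPoly s 1).re| with hc₀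
  have hlog2 : 0 ≤ Real.log 2 := Real.log_nonneg (by norm_num)
  refine ⟨c₀ / ψ 1 + B * C, by positivity, fun n => ?_⟩
  have hx := one_le_one_div_one_sub_norm (hdisc n)
  set r := (1 - ‖z n‖) / 2 with hr
  set lam := nodeLog z n r with hlam
  have hlam0 : ∀ k, 0 ≤ lam k := nodeLog_nonneg z n r
  have hlams : Summable lam := by
    refine summable_of_hasFiniteSupport ((hc.finite (hdisc n)).subset fun k hk => ?_)
    by_contra h
    refine hk ?_
    have h' : ¬‖z k - z n‖ ≤ r := h
    simp [hlam, nodeLog, h']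
  set F : ι → ℂ := fun k => if k = n then 1 else primaryFactor (kernelA (z k) (z n)) s with hF
  have hF0 : ∀ k, 0 < ‖F k‖ := by
    intro k
    rw [norm_pos_iff, hF]
    simp only
    split_ifs with h
    · exact one_ne_zero
    · exact primaryFactor_ne_zero s
        (kernelA_ne_one (hdisc k) (hne k) (hdisc n).le fun h' => h (hz h'))
  have hbound : ∀ k, |Real.log ‖F k‖ + lam k| ≤ B * ‖kernelA (z k) (z n)‖ ^ (s + 1) := by
    intro k
    by_cases h : k = n
    · simp only [hF, hlam, nodeLog, h, if_true, norm_one, Real.log_one, add_zero, abs_zero]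
      positivity
    · simp only [hF, hlam, nodeLog, h, if_false]
      exact hpt (z n) (z k) (hdisc n) (hdisc k) (hηz k) fun h' => h (hz h')
  have hAs := (hA (z n) (hdisc n)).1.mul_left B
  have habs : Summable fun k => |Real.log ‖F k‖ + lam k| :=
    Summable.of_nonneg_of_le (fun k => abs_nonneg _) hbound hAs
  have hsum2 : Summable fun k => Real.log ‖F k‖ + lam k := habs.of_abs
  -- The sums `Real.log ‖F k‖ + lam k` are summable and `lam` has finite support by (a).
  have hlogs : Summable fun k => Real.log ‖F k‖ := by
    simpa using hsum2.sub hlams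
  have hQ : ‖reducedProduct z s n (z n)‖ = Real.exp (∑' k, Real.log ‖F k‖) := by
    rw [Real.rexp_tsum_eq_tprod hF0 hlogs,
      ← (multipliable_reducedProduct hdisc hsum n (hdisc n)).norm_tprod]
    rfl
  refine ⟨∑' k, lam k, tsum_nonneg hlam0, ?_, ?_⟩
  · rw [logCount_node hz, ENNReal.ofReal_tsum_of_nonneg hlam0 hlams]
  · have hn0 : 0 < ‖z n‖ := hη.trans_le (hηz n)
    rw [norm_deriv_canonicalProduct hdisc hsum n, hQ, Real.log_mul (by positivity) (by positivity),
      Real.log_mul (by positivity) (by positivity), Real.log_exp, Real.log_exp,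
      Real.log_div (by positivity) (by positivity)]
    have h1 : |∑' k, Real.log ‖F k‖ + ∑' k, lam k| ≤ B * C * ψ (1 / (1 - ‖z n‖)) := by
      rw [← hlogs.tsum_add hlams, mul_assoc]
      calc _ ≤ ∑' k, |Real.log ‖F k‖ + lam k| := by
            have := norm_tsum_le_tsum_norm (f := fun k => Real.log ‖F k‖ + lam k) habs
            simpa only [Real.norm_eq_abs] using this
        _ ≤ ∑' k, B * ‖kernelA (z k) (z n)‖ ^ (s + 1) := habs.tsum_le_tsum hbound hAs
        _ ≤ _ := by
            rw [tsum_mul_left]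
            gcongr
            exact (hA (z n) (hdisc n)).2
    have h2 : |Real.log ‖z n‖| ≤ |Real.log η| := by
      have h3 : Real.log η ≤ Real.log ‖z n‖ := Real.log_le_log hη (hηz n)
      have h4 : Real.log ‖z n‖ ≤ 0 := Real.log_nonpos hn0.le (hdisc n).le
      rw [abs_of_nonpos h4, abs_of_nonpos (h3.trans h4)]; linarith
    have h5 : |Real.log (1 + ‖z n‖)| ≤ Real.log 2 := by
      rw [abs_of_nonneg (Real.log_nonneg (by linarith))]
      exact Real.log_le_log (by positivity) (by linarith [hdisc n])
    have h6 : c₀ ≤ c₀ / ψ 1 * ψ (1 / (1 - ‖z n‖)) := by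
      calc c₀ = c₀ / ψ 1 * ψ 1 := by field_simp
        _ ≤ _ := by
          have := hψ.mono self_mem_Ici hx hx
          gcongr
    rw [add_mul]
    obtain ⟨a1, a2⟩ := abs_le.1 h1
    obtain ⟨b1, b2⟩ := abs_le.1 h2
    obtain ⟨d1, d2⟩ := abs_le.1 h5
    have e1 := neg_abs_le (logPoly s 1).re
    have e2 := le_abs_self (logPoly s 1).re
    rw [abs_le]
    constructor <;> linarith

/-! ### From the bound on N to the bound on n -/

theorem count_mono {ι : Type*} (z : ι → ℂ) {ζ ζ' : ℂ} {t t' : ℝ} (h : ‖ζ - ζ'‖ + t ≤ t') :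
    count z ζ t ≤ count z ζ' t' := by
  refine Set.encard_le_encard fun k hk => ?_
  have hk' : ‖z k - ζ‖ ≤ t := hk
  calc ‖z k - ζ'‖ = ‖(z k - ζ) + (ζ - ζ')‖ := by ring_nf
    _ ≤ ‖z k - ζ‖ + ‖ζ - ζ'‖ := norm_add_le _ _
    _ ≤ t' := by linarith

theorem logCount_mono {ι : Type*} (z : ι → ℂ) (ζ : ℂ) {r r' : ℝ} (h : r ≤ r') :
    logCount z ζ r ≤ logCount z ζ r' :=
  lintegral_mono_set (Ioc_subset_Ioc_right h)

/-- On (r, 2r], an interval of length r, the integrand of N is at least (n(r) - 1)⁺/(2r). -/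
theorem count_le_logCount {ι : Type*} (z : ι → ℂ) (ζ : ℂ) {r : ℝ} (hr : 0 < r) :
    ((count z ζ r : ℕ∞) : ℝ≥0∞) ≤ 1 + 2 * logCount z ζ (2 * r) := by
  have h1 : ((count z ζ r - 1 : ℕ∞) : ℝ≥0∞) ≤ 2 * logCount z ζ (2 * r) := by
    have h2 : ((count z ζ r - 1 : ℕ∞) : ℝ≥0∞) / ENNReal.ofReal (2 * r) * ENNReal.ofReal r ≤
        logCount z ζ (2 * r) := by
      calc _ = ∫⁻ _ in Ioc r (2 * r),
            ((count z ζ r - 1 : ℕ∞) : ℝ≥0∞) / ENNReal.ofReal (2 * r) := by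
            rw [setLIntegral_const, Real.volume_Ioc, show 2 * r - r = r by ring]
        _ ≤ ∫⁻ t in Ioc r (2 * r), ((count z ζ t - 1 : ℕ∞) : ℝ≥0∞) / ENNReal.ofReal t := by
            refine setLIntegral_mono' measurableSet_Ioc fun t ht => ?_
            refine ENNReal.div_le_div ?_ (ENNReal.ofReal_le_ofReal ht.2)
            refine ENat.toENNReal_le.2 (tsub_le_tsub_right (count_mono z ?_) 1)
            simpa using ht.1.le
        _ ≤ _ := lintegral_mono_set (Ioc_subset_Ioc_left hr.le)
    have h3 : ENNReal.ofReal r ≠ 0 := by simpa using hr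
    calc ((count z ζ r - 1 : ℕ∞) : ℝ≥0∞) =
          2 * (((count z ζ r - 1 : ℕ∞) : ℝ≥0∞) / ENNReal.ofReal (2 * r) * ENNReal.ofReal r) := by
          rw [ENNReal.ofReal_mul (by norm_num), ENNReal.ofReal_ofNat, div_eq_mul_inv,
            ENNReal.mul_inv (by simp) (by simp)]
          rw [show ∀ a b c d : ℝ≥0∞, 2 * (a * (b * c) * d) = a * (2 * b) * (c * d) by intros; ring,
            ENNReal.mul_inv_cancel (by simp) (by simp),
            ENNReal.inv_mul_cancel h3 ENNReal.ofReal_ne_top]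
          simp
      _ ≤ _ := by gcongr
  calc ((count z ζ r : ℕ∞) : ℝ≥0∞) ≤ ((1 + (count z ζ r - 1) : ℕ∞) : ℝ≥0∞) :=
        ENat.toENNReal_le.2 le_add_tsub
    _ ≤ _ := by
        rw [ENat.toENNReal_add, ENat.toENNReal_one]
        gcongr

/-- By scaling, one cover of a fixed disc serves all ζ and δ, so the number of small discs is
uniform. -/
theorem exists_finite_cover (ζ : ℂ) {δ : ℝ} (S : Set ℂ)
    (hS : Metric.closedBall (0 : ℂ) (1 / 2) ⊆ ⋃ x ∈ S, Metric.ball x (1 / 8)) (hδ : 0 < δ)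
    {w : ℂ} (hw : ‖w - ζ‖ ≤ δ / 2) : ∃ x ∈ S, ‖w - (ζ + δ * x)‖ ≤ δ / 8 := by
  have hδ' : (δ : ℂ) ≠ 0 := by exact_mod_cast hδ.ne'
  have h1 : (w - ζ) / δ ∈ Metric.closedBall (0 : ℂ) (1 / 2) := by
    rw [mem_closedBall_zero_iff, norm_div, Complex.norm_real, Real.norm_of_nonneg hδ.le,
      div_le_iff₀ hδ]
    linarith
  obtain ⟨x, hx, h2⟩ := mem_iUnion₂.1 (hS h1)
  refine ⟨x, hx, ?_⟩
  rw [mem_ball_iff_norm] at h2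
  have h3 : w - (ζ + δ * x) = δ * ((w - ζ) / δ - x) := by field_simp; ring
  rw [h3, norm_mul, Complex.norm_real, Real.norm_of_nonneg hδ.le]
  nlinarith

theorem LogCountBound.countBound {ι : Type*} {z : ι → ℂ} {ψ : ℝ → ℝ} (hψ : ClassR ψ)
    (hp : FinitePolyaOrder ψ) (h : LogCountBound z ψ) : CountBound z ψ := by
  obtain ⟨C, hC, hlog⟩ := h
  obtain ⟨K, hK, hKψ⟩ := hψ.exists_le_mul hp 2
  obtain ⟨S, hS, hfin, hcov⟩ := finite_cover_balls_of_compact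
    (isCompact_closedBall (0 : ℂ) (1 / 2)) (show (0 : ℝ) < 1 / 8 by norm_num)
  have hψ1 := hψ.pos 1 le_rfl
  refine ⟨(hfin.toFinset.card + 1) * (1 / ψ 1 + 2 * (C * K)), by positivity, fun ζ hζ => ?_⟩
  have hδ : 0 < 1 - ‖ζ‖ := by linarith
  have hx := one_le_one_div_one_sub_norm hζ
  have hψx := hψ.pos _ hx
  have hψ1x := hψ.mono self_mem_Ici hx hx
  set δ := 1 - ‖ζ‖ with hδdef
  have hone : ∀ x ∈ S, ((count z (ζ + δ * x) (δ / 8) : ℕ∞) : ℝ≥0∞) ≤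
      ENNReal.ofReal ((1 / ψ 1 + 2 * (C * K)) * ψ (1 / δ)) := by
    intro x hxS
    have hx2 : ‖x‖ ≤ 1 / 2 := by simpa using hS hxS
    have hw : ‖ζ + δ * x‖ ≤ ‖ζ‖ + δ / 2 := by
      refine (norm_add_le _ _).trans ?_
      rw [norm_mul, Complex.norm_real, Real.norm_of_nonneg hδ.le]
      nlinarith
    have hw1 : ‖ζ + δ * x‖ < 1 := by linarith
    have h1δ : 0 < 1 - ‖ζ + δ * x‖ := by linarith
    refine (count_le_logCount z _ (by positivity)).trans ?_
    have hle : logCount z (ζ + δ * x) (2 * (δ / 8)) ≤ ENNReal.ofReal (C * (K * ψ (1 / δ))) := by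
      -- The centre ζ + δx has distance at least δ/2 from the circle, so the radius 2 · δ/8 = δ/4 is
      -- admissible there.
      refine (logCount_mono z _ (by linarith)).trans ((hlog _ hw1).trans ?_)
      refine ENNReal.ofReal_le_ofReal ?_
      have := hKψ (1 / δ) hx (1 / (1 - ‖ζ + δ * x‖)) (one_le_one_div_one_sub_norm hw1) (by
        rw [mul_one_div, div_le_div_iff₀ h1δ hδ]; linarith)
      gcongr
    calc 1 + 2 * logCount z (ζ + δ * x) (2 * (δ / 8))
        ≤ ENNReal.ofReal 1 + ENNReal.ofReal 2 * ENNReal.ofReal (C * (K * ψ (1 / δ))) := by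
          rw [ENNReal.ofReal_one, ENNReal.ofReal_ofNat]; gcongr
      _ = ENNReal.ofReal (1 + 2 * (C * (K * ψ (1 / δ)))) := by
          rw [← ENNReal.ofReal_mul (by norm_num), ← ENNReal.ofReal_add (by norm_num) (by positivity)]
      _ ≤ _ := by
          refine ENNReal.ofReal_le_ofReal ?_
          have : 1 ≤ 1 / ψ 1 * ψ (1 / δ) := by
            rw [one_div_mul_eq_div, le_div_iff₀ hψ1]; linarith
          nlinarith
  calc ((count z ζ (δ / 2) : ℕ∞) : ℝ≥0∞)
      ≤ ∑ x ∈ hfin.toFinset, ((count z (ζ + δ * x) (δ / 8) : ℕ∞) : ℝ≥0∞) := by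
        simp_rw [count_eq_tsum]
        rw [← Summable.tsum_finsetSum fun _ _ => ENNReal.summable]
        refine ENNReal.tsum_le_tsum fun k => ?_
        by_cases hk : ‖z k - ζ‖ ≤ δ / 2
        · obtain ⟨x, hxS, hxk⟩ := exists_finite_cover ζ S hcov hδ hk
          rw [indicator_of_mem (by exact hk)]
          refine le_trans ?_ (Finset.single_le_sum (fun _ _ => zero_le) (hfin.mem_toFinset.2 hxS))
          rw [indicator_of_mem (by exact hxk)]
        · rw [indicator_of_notMem (by exact hk)]
          exact zero_le
    _ ≤ ∑ _x ∈ hfin.toFinset, ENNReal.ofReal ((1 / ψ 1 + 2 * (C * K)) * ψ (1 / δ)) :=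
        Finset.sum_le_sum fun x hxS => hone x (hfin.mem_toFinset.1 hxS)
    _ = ENNReal.ofReal (hfin.toFinset.card * ((1 / ψ 1 + 2 * (C * K)) * ψ (1 / δ))) := by
        rw [Finset.sum_const, nsmul_eq_mul,
          ENNReal.ofReal_mul (p := (hfin.toFinset.card : ℝ)) (by positivity),
          ENNReal.ofReal_natCast]
    _ ≤ _ := by
        refine ENNReal.ofReal_le_ofReal ?_
        rw [mul_assoc]
        gcongr
        linarith

/-! ### From the nodes to all points of the disc -/

/-- A bound for `N_ζ` through `N` at the node closest to `ζ`. -/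
theorem logCount_le_of_closest {ι : Type*} (z : ι → ℂ) {ζ : ℂ} {δ : ℝ} (hδ : 0 < δ) (m : ι)
    (hmin : ∀ k, ‖z m - ζ‖ ≤ ‖z k - ζ‖) :
    logCount z ζ (δ / 2) ≤
      logCount z (z m) (δ / 4) + 4 * ((count z ζ (δ / 2) : ℕ∞) : ℝ≥0∞) := by
  have hsub : Ioc 0 (δ / 2) ⊆ Ioc 0 (δ / 8) ∪ Ioc (δ / 8) (δ / 2) := by
    rw [Ioc_union_Ioc_eq_Ioc (by positivity) (by linarith)]
  refine (lintegral_mono_set hsub).trans ((lintegral_union_le _ _ _).trans (add_le_add ?_ ?_))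
  · have hder : ∀ t ∈ Ioc 0 (δ / 8),
        HasDerivWithinAt (fun t : ℝ => 2 * t) 2 (Ioc 0 (δ / 8)) t := fun t _ => by
      simpa using ((hasDerivAt_id t).const_mul 2).hasDerivWithinAt
    have hinj : InjOn (fun t : ℝ => 2 * t) (Ioc 0 (δ / 8)) := fun a _ b _ h => by
      simpa using h
    have hcv := lintegral_image_eq_lintegral_abs_deriv_mul measurableSet_Ioc hder hinj
      (fun t => ((count z (z m) t - 1 : ℕ∞) : ℝ≥0∞) / ENNReal.ofReal t)
    calc _ ≤ ∫⁻ t in Ioc 0 (δ / 8), ENNReal.ofReal |2| *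
          (((count z (z m) (2 * t) - 1 : ℕ∞) : ℝ≥0∞) / ENNReal.ofReal (2 * t)) := by
          refine setLIntegral_mono' measurableSet_Ioc fun t ht => ?_
          have ht0 : ENNReal.ofReal t ≠ 0 := by simpa using ht.1
          have heq : ENNReal.ofReal |2| *
              (((count z (z m) (2 * t) - 1 : ℕ∞) : ℝ≥0∞) / ENNReal.ofReal (2 * t)) =
              ((count z (z m) (2 * t) - 1 : ℕ∞) : ℝ≥0∞) / ENNReal.ofReal t := by
            rw [abs_two, ENNReal.ofReal_mul (by norm_num), ENNReal.ofReal_ofNat, div_eq_mul_inv,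
              ENNReal.mul_inv (by simp) (by simp), div_eq_mul_inv,
              show ∀ a b c : ℝ≥0∞, 2 * (a * (b * c)) = (2 * b) * (a * c) by intros; ring,
              ENNReal.mul_inv_cancel (by simp) (by simp), one_mul]
          rw [heq]
          refine ENNReal.div_le_div (ENat.toENNReal_le.2 ?_) le_rfl
          -- Either z_m lies within t of ζ, and the disc of radius t about ζ sits in the one of
          -- radius 2t about z_m, or no node lies within t of ζ.
          by_cases hd : ‖z m - ζ‖ ≤ t
          · refine tsub_le_tsub_right (count_mono z ?_) 1
            rw [norm_sub_rev]; linarith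
          · have : count z ζ t = 0 := by
              rw [count, Set.encard_eq_zero, Set.eq_empty_iff_forall_notMem]
              intro k hk
              exact hd ((hmin k).trans hk)
            rw [this, zero_tsub]
            exact zero_le
      _ = _ := hcv.symm
      _ ≤ _ := by
          refine lintegral_mono_set ?_
          rintro _ ⟨t, ht, rfl⟩
          constructor
          · have := ht.1
            positivity
          · have := ht.2
            simp only; linarith
  -- Away from t = 0 the count itself suffices: the length 3δ/8 times 8/δ is 3, rounded up to 4.
  · calc _ ≤ ∫⁻ _ in Ioc (δ / 8) (δ / 2), ((count z ζ (δ / 2) : ℕ∞) : ℝ≥0∞) /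
          ENNReal.ofReal (δ / 8) := by
          refine setLIntegral_mono' measurableSet_Ioc fun t ht => ?_
          refine ENNReal.div_le_div ?_ (ENNReal.ofReal_le_ofReal ht.1.le)
          refine ENat.toENNReal_le.2 (tsub_le_self.trans (count_mono z ?_))
          simpa using ht.2
      _ ≤ _ := by
          have h8 : ENNReal.ofReal (δ / 8) ≠ 0 := by simpa using hδ
          have : ENNReal.ofReal (δ / 2 - δ / 8) ≤ 4 * ENNReal.ofReal (δ / 8) := by
            rw [← ENNReal.ofReal_ofNat, ← ENNReal.ofReal_mul (by norm_num)]
            exact ENNReal.ofReal_le_ofReal (by linarith)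
          rw [setLIntegral_const, Real.volume_Ioc]
          calc _ ≤ ((count z ζ (δ / 2) : ℕ∞) : ℝ≥0∞) / ENNReal.ofReal (δ / 8) *
                (4 * ENNReal.ofReal (δ / 8)) := by gcongr
            _ = 4 * ((count z ζ (δ / 2) : ℕ∞) : ℝ≥0∞) := by
              rw [div_eq_mul_inv,
                show ∀ a b c : ℝ≥0∞, a * b * (4 * c) = 4 * a * (b * c) by intros; ring,
                ENNReal.inv_mul_cancel h8 ENNReal.ofReal_ne_top, mul_one]

theorem CountBound.logCountBound {ι : Type*} {z : ι → ℂ} (hdisc : ∀ n, ‖z n‖ < 1) {ψ : ℝ → ℝ}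
    (hψ : ClassR ψ) (hp : FinitePolyaOrder ψ) (hc : CountBound z ψ) {C : ℝ} (hC : 0 < C)
    (h : ∀ n, logCount z (z n) ((1 - ‖z n‖) / 2) ≤ ENNReal.ofReal (C * ψ (1 / (1 - ‖z n‖)))) :
    LogCountBound z ψ := by
  have hc' := hc
  obtain ⟨C', hC', hcount⟩ := hc
  obtain ⟨K, hK, hKψ⟩ := hψ.exists_le_mul hp 2
  refine ⟨C * K + 4 * C', by positivity, fun ζ hζ => ?_⟩
  have hδ : 0 < 1 - ‖ζ‖ := by linarith
  have hx := one_le_one_div_one_sub_norm hζ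
  have hψx := hψ.pos _ hx
  rcases Set.eq_empty_or_nonempty {k | ‖z k - ζ‖ ≤ (1 - ‖ζ‖) / 2} with hem | hnon
  · have h0 : logCount z ζ ((1 - ‖ζ‖) / 2) = 0 := by
      rw [logCount, setLIntegral_congr_fun (g := fun _ => 0) measurableSet_Ioc]
      · simp
      · intro t ht
        have h1 : count z ζ t ≤ count z ζ ((1 - ‖ζ‖) / 2) := count_mono z (by simpa using ht.2)
        have h2 : count z ζ ((1 - ‖ζ‖) / 2) = 0 := by rw [count, hem, Set.encard_empty]
        rw [h2, nonpos_iff_eq_zero] at h1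
        simp [h1]
    rw [h0]
    exact zero_le
  · obtain ⟨m, hm, hmin⟩ := Set.exists_min_image _ (fun k => ‖z k - ζ‖) (hc'.finite hζ) hnon
    have hm' : ‖z m - ζ‖ ≤ (1 - ‖ζ‖) / 2 := hm
    have hmin' : ∀ k, ‖z m - ζ‖ ≤ ‖z k - ζ‖ := by
      intro k
      by_cases hk : ‖z k - ζ‖ ≤ (1 - ‖ζ‖) / 2
      · exact hmin k hk
      · exact hm'.trans (not_le.1 hk).le
    have hzm : ‖z m‖ - ‖ζ‖ ≤ ‖z m - ζ‖ := norm_sub_norm_le _ _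
    have hδm : (1 - ‖ζ‖) / 2 ≤ 1 - ‖z m‖ := by linarith
    refine (logCount_le_of_closest z hδ m hmin').trans ?_
    rw [add_mul, ENNReal.ofReal_add (by positivity) (by positivity)]
    refine add_le_add ?_ ?_
    -- As 1-|z_m| ≥ (1-|ζ|)/2, the radius (1-|ζ|)/4 is at most (1-|z_m|)/2, and doubling compares ψ
    -- at the two points.
    · refine (logCount_mono z _ (by linarith)).trans ((h m).trans (ENNReal.ofReal_le_ofReal ?_))
      have := hKψ _ hx _ (one_le_one_div_one_sub_norm (hdisc m)) (by
        rw [mul_one_div, div_le_div_iff₀ (by linarith) hδ]; linarith)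
      rw [mul_assoc]
      gcongr
    · rw [mul_assoc, ENNReal.ofReal_mul (by norm_num), ENNReal.ofReal_ofNat]
      gcongr
      exact hcount ζ hζ

end DiscInterpolation
-- The equivalence
open DiscInterpolation in
theorem mainTheorem6 {ι : Type*} [Countable ι] (z : ι → ℂ) (hz : Function.Injective z)
    (hdisc : ∀ n, ‖z n‖ < 1) (hne : ∀ n, z n ≠ 0)
    (ψ : ℝ → ℝ) (hψ : ClassR ψ) (hpolya : FinitePolyaOrder ψ) :
    (CountBound z ψ → Summable (fun n => (1 - ‖z n‖) ^ (genus ψ + 1))) ∧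
    (LogCountBound z ψ ↔ CountBound z ψ ∧ DerivBound z ψ) := by
  refine ⟨fun hc => hc.summable hdisc hψ hpolya, fun h => ?_, fun ⟨hc, hd⟩ => ?_⟩
  · have hc := h.countBound hψ hpolya
    refine ⟨hc, ?_⟩
    obtain ⟨C, hC, hmain⟩ := hc.exists_abs_log_deriv_add_logCount_le hz hdisc hne hψ hpolya
    obtain ⟨C', hC', hlog⟩ := h
    refine ⟨C + C', by positivity, fun n => ?_⟩
    obtain ⟨Λ, hΛ, hN, habs⟩ := hmain n
    have h1 := hlog (z n) (hdisc n)
    have hψx := hψ.pos _ (one_le_one_div_one_sub_norm (hdisc n))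
    rw [hN, ENNReal.ofReal_le_ofReal_iff (by positivity)] at h1
    rw [abs_le] at habs ⊢
    rw [add_mul]
    constructor <;> linarith
  · obtain ⟨C, hC, hmain⟩ := hc.exists_abs_log_deriv_add_logCount_le hz hdisc hne hψ hpolya
    obtain ⟨C', hC', hder⟩ := hd
    refine hc.logCountBound hdisc hψ hpolya (C := C + C') (by positivity) fun n => ?_
    obtain ⟨Λ, hΛ, hN, habs⟩ := hmain n
    have h1 := hder n
    rw [hN]
    refine ENNReal.ofReal_le_ofReal ?_
    rw [abs_le] at habs h1
    rw [add_mul]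
    linarith
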